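/- **Setting.** Let $d\ge 1$, $T>0$, and let $\Omega\subset\mathbb R^d$ be open, connected and bounded. Let $\mathcal T_h$ be a finite partition of $\Omega$ into disjoint open curved elements $K$. Each closed element is the image of a reference element (a unit simplex, a cube, or a product of unit simplices) under a polynomial map that is injective and has a nonsingular Jacobian on the closed reference element. Let $\mathcal E_h$ be the set of interior and boundary faces; each is the injective polynomial image of a reference face. Every facet of an element is a union of faces with overlaps of surface measure zero, an interior face lies on exactly two element facets, and a boundary face, i.e. a face contained in $\partial\Omega$, on exactly one. The boundary faces are split into Dirichlet faces (forming $\partial\Omega_D$) and Neumann faces (forming $\partial\Omega_N$). Let $k\ge 0$. $\mathcal Q_h$ and $\mathcal V_h$ are the spaces of $d\times d$-matrix and of vector fields, discontinuous between elements, that pull back to polynomials of degree $\le k$ on the reference elements. $\mathcal M_h$ is the space of vector fields on the faces that pull back to polynomials of degree $\le k$ on the reference faces and are continuous on the union of a given set $\mathcal E_h^E\subseteq\mathcal E_h$ of faces ($\mathcal E_h^E=\emptyset$ is the HDG method). Write $(\cdot,\cdot)=\sum_K\int_K$ and $\langle\cdot,\cdot\rangle_{\partial\mathcal T_h}=\sum_K\int_{\partial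 K}$; let $\langle\cdot,\cdot\rangle_{\partial\mathcal T_h\setminus\partial\Omega}$ be its part on interior faces, and $n$ the unit normal pointing out of $K$. The data are a density $\rho\in L^\infty(\Omega)$, a body force $f(t)\in L^2(\Omega)^d$, a boundary velocity $v_D(t)\in L^2(\partial\Omega_D)^d$, a traction $t_N(t)\in L^2(\partial\Omega_N)^d$, a measurable and, for each $t$, bounded matrix-valued stabilization tensor $S$ on $\partial\mathcal T_h$ (possibly depending on $t$ and two-valued on interior faces), and a hyperelastic energy $\psi(F)=W(F^TF)$, where $W$ (which may depend on the element) is $C^1$ on an open set of matrices, with second Piola–Kirchhoff stress $\mathbf S(F)=2\,\partial W/\partial C$ at $C=F^TF$, the derivative being taken with respect to symmetric tensors. **Scheme.** Let $(F_h,P_h,v_h,\hat v_h)(t)\in\mathcal Q_h\times\mathcal Q_h\times\mathcal V_h\times\mathcal M_h$, with $F_h,v_h$ continuous in time on $[0,T]$ and differentiable in time on $(0,T)$, and with $F_h^TF_h$ in the domain of $W$ at all points of the closed elements for all $t\in[0,T]$. Suppose that for every $t\in(0,T)$, with $\hat P_h n=P_hn-S(v_h-\hat v_h)$, $$(\partial_tF_h,G)+(v_h,\nabla\cdot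 G)-\langle\hat v_h,Gn\rangle_{\partial\mathcal T_h}=0,$$ $$(\rho\,\partial_tv_h,w)+(P_h,\nabla w)-\langle\hat P_hn,w\rangle_{\partial\mathcal T_h}-(f,w)=0,$$ $$(P_h,Q)-(F_h\mathbf S(F_h),Q)=0,$$ $$\langle\hat P_hn,\mu\rangle_{\partial\mathcal T_h\setminus\partial\Omega}+\langle\hat P_hn-t_N,\mu\rangle_{\partial\Omega_N}+\langle\hat v_h-v_D,\mu\rangle_{\partial\Omega_D}=0$$ for all $G,Q\in\mathcal Q_h$, $w\in\mathcal V_h$, $\mu\in\mathcal M_h$. Set $\partial_tE_h=\partial_t\big(\tfrac12\rho|v_h|^2\big)+P_h:\partial_tF_h$. **Conclusions.** 1. For every $t\in(0,T)$, $$(\partial_tE_h,1)+\langle S(v_h-\hat v_h),v_h-\hat v_h\rangle_{\partial\mathcal T_h}=(f,v_h)+\langle t_N,\hat v_h\rangle_{\partial\Omega_N}+\langle\hat P_hn,\hat v_h\rangle_{\partial\Omega_D}-\langle\hat v_h-v_D,\hat v_h\rangle_{\partial\Omega_D}.$$ 2. For every $t\in(0,T)$, $(P_h,\partial_tF_h)=\frac{d}{dt}\sum_K\int_K\psi(F_h)$,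 and $(\partial_tE_h,1)$ is the time derivative of the total discrete energy $\mathscr E_h(t)=\sum_K\int_K\big(\tfrac12\rho|v_h|^2+\psi(F_h)\big)$. 3. Suppose that $\mathcal E_h^E$ contains no Dirichlet face (as in the HDG method). Then $\langle\hat v_h-v_D,\hat v_h\rangle_{\partial\Omega_D}=0$ for every $t\in(0,T)$. If moreover $v_D=0$ on $\partial\Omega_D$ for all $t\in(0,T)$, then for every $t\in(0,T)$ $$(\partial_tE_h,1)+\langle S(v_h-\hat v_h),v_h-\hat v_h\rangle_{\partial\mathcal T_h}=(f,v_h)+\langle t_N,\hat v_h\rangle_{\partial\Omega_N}.$$ 4. If, in addition to all the assumptions of 3, $f=0$ and $t_N=0$ on $(0,T)$ and $S$ is positive definite ($Sw\cdot w>0$ for $w\ne0$), then $\mathscr E_h$ is non-increasing on $[0,T]$, and on $(0,T)$ $$\frac{d}{dt}\mathscr E_h=-\langle S(v_h-\hat v_h),v_h-\hat v_h\rangle_{\partial\mathcal T_h}\le0,$$ with equality at a time $t$ only if $v_h(t)=\hat v_h(t)$ almost everywhere on $\partial\mathcal T_h$. -/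

import Mathlib

open MeasureTheory Set
open scoped Matrix.Norms.Elementwise

noncomputable section

namespace HDG

/-- Vectors of `ℝ^d`; inner products are written with `⬝ᵥ` (so they are Euclidean). -/
abbrev Vec (d : ℕ) : Type := Fin d → ℝ

/-- Real `d × d` matrices. -/
abbrev Mat (d : ℕ) : Type := Matrix (Fin d) (Fin d) ℝ

/-- `A : B = tr (Aᵀ B)`. -/
def frob {d : ℕ} (A B : Mat d) : ℝ := Matrix.trace (A.transpose * B)

/-- The gradient of a vector field, `(∇ w)ᵢⱼ = ∂ⱼ wᵢ`. -/
def grad {d : ℕ} (w : Vec d → Vec d) (x : Vec d) : Mat d :=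
  Matrix.of fun i j => fderiv ℝ (fun z => w z i) x (Pi.single j 1)

/-- The row-wise divergence of a matrix field, `(∇ · G)ᵢ = ∑ⱼ ∂ⱼ Gᵢⱼ`. -/
def div {d : ℕ} (G : Vec d → Mat d) (x : Vec d) : Vec d :=
  fun i => ∑ j, fderiv ℝ (fun z => G z i j) x (Pi.single j 1)

/-- `g` coincides on `D` with a polynomial of total degree at most `k`. -/
def IsPolyOn {d : ℕ} (k : ℕ) (g : Vec d → ℝ) (D : Set (Vec d)) : Prop :=
  ∃ q : MvPolynomial (Fin d) ℝ, q.totalDegree ≤ k ∧ ∀ ξ ∈ D, g ξ = MvPolynomial.eval ξ q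

/-! ### Reference elements and their facets -/

/-- The (closed) reference element of `ℝ^d` attached to a grouping `β` of the coordinates into
blocks: the product over the blocks of the unit simplices `{ξ ≥ 0, ∑ ξᵢ ≤ 1}`.  A constant `β` gives
the unit simplex (triangle, tetrahedron), an injective `β` the unit cube (square, hexahedron), and
two blocks of sizes `2` and `1` the triangular prism. -/
def refElem {d : ℕ} (β : Fin d → ℕ) : Set (Vec d) :=
  {ξ | (∀ i, 0 ≤ ξ i) ∧ ∀ b, ∑ i with β i = b, ξ i ≤ 1}

/-- The facets of the reference element: `inl i` is the facet `ξᵢ = 0`, and `inr i`, where `i` is the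
first coordinate of its block, is the facet on which the coordinates in the block of `i` sum
to `1`. -/
abbrev Facet {n : ℕ} (β : Fin (n + 1) → ℕ) : Type :=
  Fin (n + 1) ⊕ {i : Fin (n + 1) // ∀ j, β j = β i → i ≤ j}

/-- The coordinate that is eliminated when a facet is written as a graph. -/
def facetIndex {n : ℕ} {β : Fin (n + 1) → ℕ} : Facet β → Fin (n + 1)
  | Sum.inl i => i
  | Sum.inr i => i.1

/-- The parameter domain of a facet (a reference element of `ℝ^n`). -/
def facetDomain {n : ℕ} {β : Fin (n + 1) → ℕ} (j : Facet β) : Set (Vec n) :=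
  refElem fun i => β ((facetIndex j).succAbove i)

/-- The parametrization of a facet as a graph over its parameter domain. -/
def facetMap {n : ℕ} {β : Fin (n + 1) → ℕ} : Facet β → Vec n → Vec (n + 1)
  | Sum.inl i, y => i.insertNth 0 y
  | Sum.inr i, y => i.1.insertNth (1 - ∑ l with β (i.1.succAbove l) = β i.1, y l) y

/-- The outward area vector of a facet with respect to its parametrization: outward unit normal
times area element. It is `-eᵢ` for the facet `ξᵢ = 0`, and the indicator of the block of `i` for the
facet on which the coordinates of that block sum to `1`. -/
def facetAreaVec {n : ℕ} {β : Fin (n + 1) → ℕ} : Facet β → Vec (n + 1)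
  | Sum.inl i => -Pi.single i 1
  | Sum.inr i => fun j => if β j = β i.1 then 1 else 0

/-- The polynomial map with components `q`. -/
def polyMap {m d : ℕ} (q : Fin d → MvPolynomial (Fin m) ℝ) (ξ : Vec m) : Vec d :=
  fun i => MvPolynomial.eval ξ (q i)

/-- The Jacobian matrix of a polynomial map. -/
def polyJac {d : ℕ} (q : Fin d → MvPolynomial (Fin d) ℝ) (ξ : Vec d) : Mat d :=
  Matrix.of fun i j => MvPolynomial.eval ξ (MvPolynomial.pderiv j (q i))

/-! ### Meshes -/

/-- A mesh of `Ω ⊆ ℝ^(n+1)` by curved elements of degree `p`, together with its faces.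
Faces may be proper parts of element facets, so hanging nodes are allowed. -/
structure Mesh (n p : ℕ) (Ω : Set (Vec (n + 1))) where
  /-- The elements. -/
  Elem : Type
  /-- The interior and boundary faces (the mesh skeleton). -/
  Face : Type
  fintypeElem : Fintype Elem
  fintypeFace : Fintype Face
  /-- The reference element of each element. -/
  elemRef : Elem → Fin (n + 1) → ℕ
  /-- The parametric mapping from the reference element to each element; `p` bounds its total degree
  (so a multilinear map of a square has `p = 2`). -/
  elemPoly : Elem → Fin (n + 1) → MvPolynomial (Fin (n + 1)) ℝ
  elemPoly_degree : ∀ K i, (elemPoly K i).totalDegree ≤ p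
  elemPoly_injOn : ∀ K, InjOn (polyMap (elemPoly K)) (refElem (elemRef K))
  elemPoly_det : ∀ K, ∀ ξ ∈ refElem (elemRef K), (polyJac (elemPoly K) ξ).det ≠ 0
  /-- The open elements are contained in `Ω`. -/
  elem_subset : ∀ K, polyMap (elemPoly K) '' interior (refElem (elemRef K)) ⊆ Ω
  /-- The open elements are pairwise disjoint. -/
  elem_disjoint : ∀ K K', K ≠ K' →
    Disjoint (polyMap (elemPoly K) '' interior (refElem (elemRef K)))
      (polyMap (elemPoly K') '' interior (refElem (elemRef K')))
  /-- The closed elements cover the closure of `Ω`. -/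
  elem_cover : ⋃ K, polyMap (elemPoly K) '' refElem (elemRef K) = closure Ω
  /-- The reference face of each face. -/
  faceRef : Face → Fin n → ℕ
  /-- The parametric mapping from the reference face to each face. -/
  facePoly : Face → Fin (n + 1) → MvPolynomial (Fin n) ℝ
  facePoly_degree : ∀ F i, (facePoly F i).totalDegree ≤ p
  facePoly_injOn : ∀ F, InjOn (polyMap (facePoly F)) (refElem (faceRef F))
  /-- Every facet of an element is the union of the faces that it contains. -/
  facet_eq_union : ∀ K (j : Facet (elemRef K)),
    (fun y => polyMap (elemPoly K) (facetMap j y)) '' facetDomain j =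
      ⋃ F ∈ {F | polyMap (facePoly F) '' refElem (faceRef F) ⊆
          (fun y => polyMap (elemPoly K) (facetMap j y)) '' facetDomain j},
        polyMap (facePoly F) '' refElem (faceRef F)
  /-- Distinct faces overlap in a set of surface measure zero. -/
  face_overlap : ∀ K (j : Facet (elemRef K)) F F', F ≠ F' →
    volume {y ∈ facetDomain j | polyMap (elemPoly K) (facetMap j y) ∈
      (polyMap (facePoly F) '' refElem (faceRef F)) ∩
        (polyMap (facePoly F') '' refElem (faceRef F'))} = 0
  /-- A face on the boundary of `Ω` belongs to exactly one facet of one element. -/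
  face_boundary : ∀ F, polyMap (facePoly F) '' refElem (faceRef F) ⊆ frontier Ω →
    Nat.card {q : Σ K, Facet (elemRef K) // polyMap (facePoly F) '' refElem (faceRef F) ⊆
      (fun y => polyMap (elemPoly q.1) (facetMap q.2 y)) '' facetDomain q.2} = 1
  /-- Every other face is shared by exactly two facets of elements. -/
  face_interior : ∀ F, ¬ polyMap (facePoly F) '' refElem (faceRef F) ⊆ frontier Ω →
    Nat.card {q : Σ K, Facet (elemRef K) // polyMap (facePoly F) '' refElem (faceRef F) ⊆
      (fun y => polyMap (elemPoly q.1) (facetMap q.2 y)) '' facetDomain q.2} = 2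

namespace Mesh

variable {n p : ℕ} {Ω : Set (Vec (n + 1))} (M : Mesh n p Ω)

instance : Fintype M.Elem := M.fintypeElem

instance : Fintype M.Face := M.fintypeFace

/-- The parametric mapping of the element `K`. -/
def elemMap (K : M.Elem) : Vec (n + 1) → Vec (n + 1) := polyMap (M.elemPoly K)

/-- The (open) element `K`. -/
def elemSet (K : M.Elem) : Set (Vec (n + 1)) := M.elemMap K '' interior (refElem (M.elemRef K))

/-- The closed element. -/
def closedElem (K : M.Elem) : Set (Vec (n + 1)) := M.elemMap K '' refElem (M.elemRef K)

/-- The parametric mapping of the face `F`. -/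
def faceMap (F : M.Face) : Vec n → Vec (n + 1) := polyMap (M.facePoly F)

/-- The point set of the face `F`. -/
def faceSet (F : M.Face) : Set (Vec (n + 1)) := M.faceMap F '' refElem (M.faceRef F)

/-- The faces that lie on the boundary of `Ω`. -/
def boundaryFaces : Set M.Face := {F | M.faceSet F ⊆ frontier Ω}

/-- The parametrization of the facet `j` of the element `K`. -/
def facetPoint (K : M.Elem) (j : Facet (M.elemRef K)) (y : Vec n) : Vec (n + 1) :=
  M.elemMap K (facetMap j y)

/-- The point set of the facet `j` of the element `K`. -/
def facetSet (K : M.Elem) (j : Facet (M.elemRef K)) : Set (Vec (n + 1)) :=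
  M.facetPoint K j '' facetDomain j

/-- The Jacobian matrix of the element mapping at a point of a facet. -/
def facetJac (K : M.Elem) (j : Facet (M.elemRef K)) (y : Vec n) : Mat (n + 1) :=
  polyJac (M.elemPoly K) (facetMap j y)

/-- The area vector of the parametrized surface `facetPoint K j`, by Nanson's formula: the cofactor
matrix of the element mapping applied to the area vector of the reference facet. Up to its sign it is
the cross product of the tangent vectors of the parametrization. -/
def areaVec (K : M.Elem) (j : Facet (M.elemRef K)) (y : Vec n) : Vec (n + 1) :=
  (M.facetJac K j y).adjugate.transpose.mulVec (facetAreaVec j)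

/-- The area element of the parametrized surface `facetPoint K j` (a Euclidean norm). -/
def areaElement (K : M.Elem) (j : Facet (M.elemRef K)) (y : Vec n) : ℝ :=
  Real.sqrt (M.areaVec K j y ⬝ᵥ M.areaVec K j y)

/-- The unit normal vector on `∂K` that points out of `K`; the sign of the Jacobian determinant
makes it outward also if the element mapping reverses the orientation. -/
def normal (K : M.Elem) (j : Facet (M.elemRef K)) (y : Vec n) : Vec (n + 1) :=
  (Real.sign (M.facetJac K j y).det / M.areaElement K j y) • M.areaVec K j y

/-- The surface measure of the facet `j` of `K`, in the parameters of that facet. -/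
def facetMeasure (K : M.Elem) (j : Facet (M.elemRef K)) : Measure (Vec n) :=
  (volume.restrict (facetDomain j)).withDensity fun y => ENNReal.ofReal (M.areaElement K j y)

/-- The part of the facet `j` of `K` that lies on the face `F`, in the parameters of the facet. -/
def facePart (K : M.Elem) (j : Facet (M.elemRef K)) (F : M.Face) : Set (Vec n) :=
  {y | M.facetPoint K j y ∈ M.faceSet F}

/-- `∑_K ∫_K g_K`. -/
def elemSum (g : M.Elem → Vec (n + 1) → ℝ) : ℝ := ∑ K, ∫ x in M.elemSet K, g K x

open Classical in
/-- The sum, over all elements `K`, of the surface integrals over the faces of `∂K` that belong to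
the set `A` of faces. The integrand `g K j F x ν` is evaluated at the point `x` of the face and at
the outward unit normal `ν` of `K`. With `A = univ` this is an integral over `∂𝒯_h`, in which
interior faces are counted twice; boundary faces are counted once. -/
def faceSum (A : Set M.Face)
    (g : (K : M.Elem) → Facet (M.elemRef K) → M.Face → Vec (n + 1) → Vec (n + 1) → ℝ) : ℝ :=
  ∑ K, ∑ j : Facet (M.elemRef K), ∑ F with F ∈ A ∧ M.faceSet F ⊆ M.facetSet K j,
    ∫ y in M.facePart K j F, g K j F (M.facetPoint K j y) (M.normal K j y) ∂(M.facetMeasure K j)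

/-- The discontinuous space of matrix fields that pull back to polynomials of degree at most `k` on
the reference elements. -/
def Q (k : ℕ) : Set (M.Elem → Vec (n + 1) → Mat (n + 1)) :=
  {G | ∀ K i j, IsPolyOn k (fun ξ => G K (M.elemMap K ξ) i j) (refElem (M.elemRef K))}

/-- The discontinuous space of vector fields that pull back to polynomials of degree at most `k` on
the reference elements. -/
def V (k : ℕ) : Set (M.Elem → Vec (n + 1) → Vec (n + 1)) :=
  {w | ∀ K i, IsPolyOn k (fun ξ => w K (M.elemMap K ξ) i) (refElem (M.elemRef K))}

/-- The trace space on the skeleton: face by face polynomials of degree at most `k`, continuous on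
the union of the faces in `EE`. `EE = ∅` is the hybridizable method, `EE = univ` the embedded one, and
the set of interior faces gives the interior embedded one. -/
def Trace (k : ℕ) (EE : Set M.Face) : Set (M.Face → Vec (n + 1) → Vec (n + 1)) :=
  {μ | (∀ F i, IsPolyOn k (fun s => μ F (M.faceMap F s) i) (refElem (M.faceRef F))) ∧
    ∀ F ∈ EE, ∀ F' ∈ EE, ∀ x ∈ M.faceSet F ∩ M.faceSet F', μ F x = μ F' x}

end Mesh

/-! ### Hyperelastic material -/

/-- The second Piola-Kirchhoff stress `𝐒(F) = 2 ∂ψ/∂C` at `C = Fᵀ F` of the strain energy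
`ψ(F) = W (Fᵀ F)`. Here `∂ψ/∂C` is the derivative with respect to a symmetric tensor, that is, the
symmetric part of the gradient of `W`. -/
def piola2 {d : ℕ} (W : Mat d → ℝ) (F : Mat d) : Mat d :=
  Matrix.of fun i j =>
    fderiv ℝ W (F.transpose * F) (Matrix.single i j 1) +
      fderiv ℝ W (F.transpose * F) (Matrix.single j i 1)

variable {n p : ℕ} {Ω : Set (Vec (n + 1))}

/-- The data of the nonlinear elastodynamics problem and of its discretization. -/
structure Data (M : Mesh n p Ω) where
  /-- The density of the reference configuration. -/
  rho : Vec (n + 1) → ℝ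
  /-- The body force, as a function of time and position. -/
  f : ℝ → Vec (n + 1) → Vec (n + 1)
  /-- The faces that make up the Dirichlet boundary; the others on `∂Ω` make up the Neumann one. -/
  dirichlet : Set M.Face
  /-- The prescribed boundary velocity. -/
  vD : ℝ → Vec (n + 1) → Vec (n + 1)
  /-- The prescribed boundary traction. -/
  tN : ℝ → Vec (n + 1) → Vec (n + 1)
  /-- The strain energy as a function of `C = Fᵀ F`; the material may change between elements. -/
  W : M.Elem → Mat (n + 1) → ℝ
  /-- The domain of the strain energy (for example all matrices, or those with `det C > 0`). -/
  dom : M.Elem → Set (Mat (n + 1))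
  /-- The stabilization tensor on the facets of the elements; it may be two-valued on a face. -/
  S : ℝ → (K : M.Elem) → Facet (M.elemRef K) → Vec (n + 1) → Mat (n + 1)

namespace Data

variable {M : Mesh n p Ω} (D : Data M)

/-- The faces of the Neumann boundary. -/
def neumann : Set M.Face := M.boundaryFaces \ D.dirichlet

/-- Standing assumptions on the data on the time interval `(0, T)`. -/
structure Admissible (T : ℝ) : Prop where
  dirichlet_subset : D.dirichlet ⊆ M.boundaryFaces
  rho_bounded : MemLp D.rho ⊤ (volume.restrict Ω)
  f_memLp : ∀ t ∈ Ioo 0 T, MemLp (D.f t) 2 (volume.restrict Ω)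
  vD_memLp : ∀ t ∈ Ioo 0 T, ∀ K (j : Facet (M.elemRef K)), ∀ F ∈ D.dirichlet,
    M.faceSet F ⊆ M.facetSet K j →
      MemLp (fun y => D.vD t (M.facetPoint K j y)) 2
        ((M.facetMeasure K j).restrict (M.facePart K j F))
  tN_memLp : ∀ t ∈ Ioo 0 T, ∀ K (j : Facet (M.elemRef K)), ∀ F ∈ D.neumann,
    M.faceSet F ⊆ M.facetSet K j →
      MemLp (fun y => D.tN t (M.facetPoint K j y)) 2
        ((M.facetMeasure K j).restrict (M.facePart K j F))
  dom_open : ∀ K, IsOpen (D.dom K)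
  W_contDiff : ∀ K, ContDiffOn ℝ 1 (D.W K) (D.dom K)
  S_bounded : ∀ t ∈ Ioo 0 T, ∀ K (j : Facet (M.elemRef K)),
    MemLp (fun y => D.S t K j (M.facetPoint K j y)) ⊤ (M.facetMeasure K j)

/-- The jump `v_h - v̂_h` on the face `F` of `∂K`. -/
def jump (v : M.Elem → Vec (n + 1) → Vec (n + 1)) (vhat : M.Face → Vec (n + 1) → Vec (n + 1))
    (K : M.Elem) (F : M.Face) (x : Vec (n + 1)) : Vec (n + 1) :=
  v K x - vhat F x

/-- The numerical flux `P̂_h ν = P_h ν - S (v_h - v̂_h)` at time `t`. -/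
def flux (t : ℝ) (P : M.Elem → Vec (n + 1) → Mat (n + 1))
    (v : M.Elem → Vec (n + 1) → Vec (n + 1)) (vhat : M.Face → Vec (n + 1) → Vec (n + 1))
    (K : M.Elem) (j : Facet (M.elemRef K)) (F : M.Face) (x ν : Vec (n + 1)) : Vec (n + 1) :=
  (P K x).mulVec ν - (D.S t K j x).mulVec (jump v vhat K F x)

/-- `(F, P, v, vhat)` is a solution on `[0, T]` of the semi-discrete scheme of polynomial degree `k`
for nonlinear elastodynamics, with trace space `M.Trace k EE`. -/
structure IsSolution (k : ℕ) (EE : Set M.Face) (T : ℝ)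
    (F P : ℝ → M.Elem → Vec (n + 1) → Mat (n + 1))
    (v : ℝ → M.Elem → Vec (n + 1) → Vec (n + 1))
    (vhat : ℝ → M.Face → Vec (n + 1) → Vec (n + 1)) : Prop where
  F_mem : ∀ t ∈ Icc 0 T, F t ∈ M.Q k
  P_mem : ∀ t ∈ Ioo 0 T, P t ∈ M.Q k
  v_mem : ∀ t ∈ Icc 0 T, v t ∈ M.V k
  vhat_mem : ∀ t ∈ Ioo 0 T, vhat t ∈ M.Trace k EE
  F_cont : ∀ K, ∀ x ∈ M.closedElem K, ContinuousOn (fun s => F s K x) (Icc 0 T)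
  v_cont : ∀ K, ∀ x ∈ M.closedElem K, ContinuousOn (fun s => v s K x) (Icc 0 T)
  F_diff : ∀ t ∈ Ioo 0 T, ∀ K, ∀ x ∈ M.closedElem K, DifferentiableAt ℝ (fun s => F s K x) t
  v_diff : ∀ t ∈ Ioo 0 T, ∀ K, ∀ x ∈ M.closedElem K, DifferentiableAt ℝ (fun s => v s K x) t
  /-- The deformation gradient stays in the domain of the strain energy. -/
  F_dom : ∀ t ∈ Icc 0 T, ∀ K, ∀ x ∈ M.closedElem K, (F t K x).transpose * F t K x ∈ D.dom K
  /-- `(∂ₜF_h, G) + (v_h, ∇·G) - ⟨v̂_h, G n⟩ = 0`. -/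
  kinematic : ∀ t ∈ Ioo 0 T, ∀ G ∈ M.Q k,
    M.elemSum (fun K x => frob (deriv (fun s => F s K x) t) (G K x)) +
      M.elemSum (fun K x => v t K x ⬝ᵥ div (G K) x) -
      M.faceSum univ (fun K _ E x ν => vhat t E x ⬝ᵥ (G K x).mulVec ν) = 0
  /-- `(ρ ∂ₜv_h, w) + (P_h, ∇w) - ⟨P̂_h n, w⟩ - (f, w) = 0`. -/
  momentum : ∀ t ∈ Ioo 0 T, ∀ w ∈ M.V k,
    M.elemSum (fun K x => D.rho x * (deriv (fun s => v s K x) t ⬝ᵥ w K x)) +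
      M.elemSum (fun K x => frob (P t K x) (grad (w K) x)) -
      M.faceSum univ (fun K j E x ν => D.flux t (P t) (v t) (vhat t) K j E x ν ⬝ᵥ w K x) -
      M.elemSum (fun K x => D.f t x ⬝ᵥ w K x) = 0
  /-- `(P_h, Q) - (F_h 𝐒(F_h), Q) = 0`. -/
  constitutive : ∀ t ∈ Ioo 0 T, ∀ R ∈ M.Q k,
    M.elemSum (fun K x => frob (P t K x) (R K x)) -
      M.elemSum (fun K x => frob (F t K x * piola2 (D.W K) (F t K x)) (R K x)) = 0
  /-- `⟨P̂_h n, μ⟩_{∂𝒯_h \ ∂Ω} + ⟨P̂_h n - t_N, μ⟩_{∂Ω_N} + ⟨v̂_h - v_D, μ⟩_{∂Ω_D} = 0`. -/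
  transmission : ∀ t ∈ Ioo 0 T, ∀ μ ∈ M.Trace k EE,
    M.faceSum M.boundaryFacesᶜ
        (fun K j E x ν => D.flux t (P t) (v t) (vhat t) K j E x ν ⬝ᵥ μ E x) +
      M.faceSum D.neumann
        (fun K j E x ν => (D.flux t (P t) (v t) (vhat t) K j E x ν - D.tN t x) ⬝ᵥ μ E x) +
      M.faceSum D.dirichlet (fun _ _ E x _ => (vhat t E x - D.vD t x) ⬝ᵥ μ E x) = 0

/-- The discrete kinetic energy `∑_K ∫_K ½ ρ |v_h|²`. -/
def kineticEnergy (v : ℝ → M.Elem → Vec (n + 1) → Vec (n + 1)) (t : ℝ) : ℝ :=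
  M.elemSum fun K x => 1 / 2 * D.rho x * (v t K x ⬝ᵥ v t K x)

/-- The discrete elastic energy `∑_K ∫_K ψ(F_h)`. -/
def elasticEnergy (F : ℝ → M.Elem → Vec (n + 1) → Mat (n + 1)) (t : ℝ) : ℝ :=
  M.elemSum fun K x => D.W K ((F t K x).transpose * F t K x)

/-- `(∂ₜE_h, 1)`, with `∂ₜE_h = ∂ₜ(½ ρ |v_h|²) + P_h : ∂ₜF_h`. -/
def energyRate (F P : ℝ → M.Elem → Vec (n + 1) → Mat (n + 1))
    (v : ℝ → M.Elem → Vec (n + 1) → Vec (n + 1)) (t : ℝ) : ℝ :=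
  M.elemSum fun K x =>
    deriv (fun s => 1 / 2 * D.rho x * (v s K x ⬝ᵥ v s K x)) t +
      frob (P t K x) (deriv (fun s => F s K x) t)

/-- `⟨S (v_h - v̂_h), v_h - v̂_h⟩_{∂𝒯_h}`. -/
def dissipation (v : ℝ → M.Elem → Vec (n + 1) → Vec (n + 1))
    (vhat : ℝ → M.Face → Vec (n + 1) → Vec (n + 1)) (t : ℝ) : ℝ :=
  M.faceSum univ fun K j E x _ =>
    (D.S t K j x).mulVec (jump (v t) (vhat t) K E x) ⬝ᵥ jump (v t) (vhat t) K E x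

end Data

end HDG

end

noncomputable section

namespace HDG

/-! ### Calculus of polynomials -/

/-! The energy identity comes from testing the scheme with its own solution. Take `G = P_h` in the
kinematic equation and `w = v_h` in the momentum equation, and add. Green's formula turns `(v_h,
∇·P_h) + (P_h, ∇v_h)` into `⟨P_h n, v_h⟩`. What is left on the skeleton is `P_h n · (v_h - v̂_h) -
P̂_h n · v_h`, and by the definition of the flux this equals `S(v_h - v̂_h) · (v_h - v̂_h) - P̂_h n
· v̂_h`. The transmission condition tested with `μ = v̂_h` expresses the power of the flux on the
skeleton by boundary terms alone (`IsSolution.faceSum_flux_trace`, `IsSolution.energy_identity`).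

Green's formula has to hold exactly for the normals and surface measures of the mesh, which are
defined by Nanson's formula. On a reference element it is Fubini and the fundamental theorem of
calculus. It passes to a curved element through the Piola identity: the columns of the adjugate
Jacobian are divergence free, so `det J · ∂ᵢg` pulls back to the divergence of a polynomial field
(`sum_pderiv_adjugate_eq_zero`, `PullsBack.integral_fderiv`). Since the faces tile every facet up to
null sets, facet integrals agree with the face sums of the scheme (`faceSum_univ_eq`).

For the rates of the energies, a discrete field is a finite sum of fixed spatial functions whose
coefficients are its values at nodes (`exists_nodalBasis`). Pointwise regularity in time therefore
becomes regularity of finitely many coefficients. It follows that `∂ₜF_h` lies in `Q_h`, and that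
the energies may be differentiated under the integral (`hasDerivAt_energy`). The first variation of
`ψ` is `F 𝐒(F)`; the constitutive equation tested with `∂ₜF_h` replaces it by `P_h`.

If no Dirichlet face carries a continuity constraint, `v̂_h` cut off to the Dirichlet faces is an
admissible trace, and this removes the Dirichlet residual. For `v_D = 0` it even forces `v̂_h = 0`
almost everywhere there, so the Dirichlet power vanishes too. Decay follows because the energy is
continuous on `[0, T]` with derivative minus the dissipation inside. -/

theorem hasStrictFDerivAt_eval {m : ℕ} (q : MvPolynomial (Fin m) ℝ) (x : Vec m) :
    HasStrictFDerivAt (fun x => MvPolynomial.eval x q)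
      (∑ i, MvPolynomial.eval x (MvPolynomial.pderiv i q) •
        ContinuousLinearMap.proj (R := ℝ) (φ := fun _ : Fin m => ℝ) i) x := by
  induction q using MvPolynomial.induction_on with
  | C a =>
    simp only [MvPolynomial.eval_C, MvPolynomial.pderiv_C, map_zero, zero_smul, Finset.sum_const_zero]
    exact hasStrictFDerivAt_const a x
  | add p q hp hq =>
    simp only [map_add, add_smul, Finset.sum_add_distrib]
    exact hp.add hq
  | mul_X p i hp =>
    have h := hp.mul (ContinuousLinearMap.proj (R := ℝ) (φ := fun _ : Fin m => ℝ) i).hasStrictFDerivAt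
    simp only [map_mul, MvPolynomial.eval_X]
    refine h.congr_fderiv ?_
    ext z
    simp [MvPolynomial.pderiv_X, Pi.single_apply, add_mul, Finset.sum_add_distrib, Finset.mul_sum,
      apply_ite, mul_assoc]

theorem continuous_polyMap {m d : ℕ} (q : Fin d → MvPolynomial (Fin m) ℝ) :
    Continuous (polyMap q) :=
  continuous_pi fun i => MvPolynomial.continuous_eval (q i)

/-- Strict differentiability is what the local inverse in `PullsBack.differentiableAt` requires. -/
theorem hasStrictFDerivAt_polyMap {d : ℕ} (q : Fin d → MvPolynomial (Fin d) ℝ) (x : Vec d) :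
    HasStrictFDerivAt (polyMap q) (Matrix.toLin' (polyJac q x)).toContinuousLinearMap x := by
  rw [hasStrictFDerivAt_pi']
  intro i
  refine (hasStrictFDerivAt_eval (q i) x).congr_fderiv ?_
  ext z
  simp [polyJac, Matrix.mulVec, dotProduct]

/-! ### Reference elements -/

theorem convex_refElem {d : ℕ} (β : Fin d → ℕ) : Convex ℝ (refElem β) := by
  intro x hx y hy a b ha hb hab
  refine ⟨fun i => ?_, fun c => ?_⟩
  · have := hx.1 i; have := hy.1 i
    simp only [Pi.add_apply, Pi.smul_apply, smul_eq_mul]; positivity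
  · simp only [Pi.add_apply, Pi.smul_apply, smul_eq_mul, Finset.sum_add_distrib, ← Finset.mul_sum]
    nlinarith [hx.2 c, hy.2 c, mul_le_mul_of_nonneg_left (hx.2 c) ha,
      mul_le_mul_of_nonneg_left (hy.2 c) hb]

theorem isClosed_refElem {d : ℕ} (β : Fin d → ℕ) : IsClosed (refElem β) := by
  have : refElem β = (⋂ i, {ξ : Vec d | 0 ≤ ξ i}) ∩ ⋂ b, {ξ | ∑ i with β i = b, ξ i ≤ 1} := by
    ext; simp [refElem]
  rw [this]
  exact (isClosed_iInter fun i => isClosed_le continuous_const (continuous_apply i)).inter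
    (isClosed_iInter fun b => isClosed_le (by fun_prop) continuous_const)

theorem refElem_subset_Icc {d : ℕ} (β : Fin d → ℕ) : refElem β ⊆ Icc 0 1 := by
  intro x hx
  refine ⟨fun i => hx.1 i, fun i => ?_⟩
  exact (Finset.single_le_sum (f := x) (s := {j | β j = β i}) (fun j _ => hx.1 j) (by simp)).trans
    (hx.2 _)

theorem isCompact_refElem {d : ℕ} (β : Fin d → ℕ) : IsCompact (refElem β) :=
  isCompact_Icc.of_isClosed_subset (isClosed_refElem β) (refElem_subset_Icc β)

theorem zero_mem_refElem {d : ℕ} (β : Fin d → ℕ) : (0 : Vec d) ∈ refElem β := by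
  simp [refElem]

/-- The frontier of a convex set is null. This reconciles elements, which are images of open sets,
with the divergence theorem on the closed reference element. -/
theorem interior_refElem_ae_eq {d : ℕ} (β : Fin d → ℕ) :
    interior (refElem β) =ᵐ[volume] refElem β :=
  interior_ae_eq_of_null_frontier ((convex_refElem β).addHaar_frontier volume)

theorem sum_insertNth {n : ℕ} (β : Fin (n + 1) → ℕ) (a : Fin (n + 1)) (s : ℝ) (y : Vec n) (b : ℕ) :
    ∑ i with β i = b, (a.insertNth s y : Vec (n + 1)) i =
      (if β a = b then s else 0) + ∑ l with β (a.succAbove l) = b, y l := by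
  simp only [Finset.sum_filter]
  rw [Fin.sum_univ_succAbove _ a]
  simp

/-- Only the block containing `a` constrains the coordinate `a`, so the slices in that direction are
intervals. They end on the facet `ξ_a = 0` and on the oblique facet of the block. -/
theorem insertNth_mem_refElem {n : ℕ} (β : Fin (n + 1) → ℕ) (a : Fin (n + 1)) (s : ℝ) (y : Vec n) :
    (a.insertNth s y : Vec (n + 1)) ∈ refElem β ↔
      y ∈ refElem (fun l => β (a.succAbove l)) ∧
        s ∈ Icc 0 (1 - ∑ l with β (a.succAbove l) = β a, y l) := by
  simp only [refElem, mem_ofPred_eq, sum_insertNth, Fin.forall_iff_succAbove a,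
    Fin.insertNth_apply_same, Fin.insertNth_apply_succAbove, mem_Icc]
  constructor
  · rintro ⟨⟨hs, hy⟩, h⟩
    refine ⟨⟨hy, fun b => ?_⟩, hs, ?_⟩
    · have := h b; split_ifs at this <;> linarith
    · have := h (β a); simp at this; linarith
  · rintro ⟨⟨hy, h⟩, hs, hs'⟩
    refine ⟨⟨hs, hy⟩, fun b => ?_⟩
    split_ifs with hb
    · subst hb; linarith
    · simpa using h b

theorem facetMap_mem_refElem {n : ℕ} {β : Fin (n + 1) → ℕ} (j : Facet β) {y : Vec n}
    (hy : y ∈ facetDomain j) : facetMap j y ∈ refElem β := by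
  rcases j with i | i
  · refine (insertNth_mem_refElem β i 0 y).2 ⟨hy, le_rfl, ?_⟩
    exact sub_nonneg.2 (hy.2 (β i))
  · refine (insertNth_mem_refElem β i.1 _ y).2 ⟨hy, ?_, le_rfl⟩
    exact sub_nonneg.2 (hy.2 (β i.1))

theorem continuous_insertNth {X : Type*} [TopologicalSpace X] {n : ℕ} (a : Fin (n + 1)) {f : X → ℝ}
    {g : X → Vec n} (hf : Continuous f) (hg : Continuous g) :
    Continuous fun x => (a.insertNth (f x) (g x) : Vec (n + 1)) :=
  Continuous.finInsertNth (A := fun _ => ℝ) a hf hg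

theorem continuous_facetMap {n : ℕ} {β : Fin (n + 1) → ℕ} (j : Facet β) :
    Continuous (facetMap j : Vec n → Vec (n + 1)) := by
  rcases j with i | i
  · exact continuous_insertNth i continuous_const continuous_id
  · exact continuous_insertNth i.1 (by fun_prop) continuous_id

/-- Integration of a partial derivative over a reference element. -/
theorem integral_refElem_pderiv {n : ℕ} (β : Fin (n + 1) → ℕ) (a : Fin (n + 1))
    (h : MvPolynomial (Fin (n + 1)) ℝ) :
    ∫ ξ in refElem β, MvPolynomial.eval ξ (MvPolynomial.pderiv a h) =
      (∫ y in refElem (fun l => β (a.succAbove l)), MvPolynomial.eval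
        (a.insertNth (1 - ∑ l with β (a.succAbove l) = β a, y l) y : Vec (n + 1)) h) -
      ∫ y in refElem (fun l => β (a.succAbove l)),
        MvPolynomial.eval (a.insertNth 0 y : Vec (n + 1)) h := by
  set g : Vec (n + 1) → ℝ := fun ξ => MvPolynomial.eval ξ (MvPolynomial.pderiv a h) with hg
  have hgc : Continuous g := MvPolynomial.continuous_eval _
  set G : Vec (n + 1) → ℝ := (refElem β).indicator g with hG
  have hGi : Integrable G := (integrable_indicator_iff (isClosed_refElem β).measurableSet).2
    (hgc.continuousOn.integrableOn_compact (isCompact_refElem β))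
  have mp := (volume_preserving_piFinSuccAbove (fun _ : Fin (n + 1) => ℝ) a).symm
  have hGi' : Integrable (fun z : ℝ × Vec n => G (a.insertNth z.1 z.2)) :=
    (mp.integrable_comp_emb (MeasurableEquiv.measurableEmbedding _)).2 hGi
  have e1 : ∫ ξ, G ξ = ∫ y : Vec n, ∫ s : ℝ, G (a.insertNth s y) := by
    rw [← mp.integral_comp' G]
    exact integral_prod_symm (fun z : ℝ × Vec n => G (a.insertNth z.1 z.2)) hGi'
  rw [← integral_indicator (isClosed_refElem β).measurableSet]
  refine e1.trans ?_
  set D := refElem (fun l => β (a.succAbove l)) with hD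
  have c1 : Continuous fun y : Vec n => MvPolynomial.eval
        (a.insertNth (1 - ∑ l with β (a.succAbove l) = β a, y l) y : Vec (n + 1)) h :=
    (MvPolynomial.continuous_eval h).comp
      (continuous_insertNth a (by fun_prop) continuous_id)
  have c2 : Continuous fun y : Vec n => MvPolynomial.eval (a.insertNth 0 y : Vec (n + 1)) h :=
    (MvPolynomial.continuous_eval h).comp
      (continuous_insertNth a continuous_const continuous_id)
  rw [← integral_sub (c1.continuousOn.integrableOn_compact (isCompact_refElem _))
    (c2.continuousOn.integrableOn_compact (isCompact_refElem _)),
    ← integral_indicator (isClosed_refElem _).measurableSet]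
  congr 1
  funext y
  -- For `y` in `D` the slice is an interval `[0, r]` and the fundamental theorem of calculus
  -- applies. Otherwise the slice is empty and both sides vanish.
  by_cases hy : y ∈ D
  · set r := 1 - ∑ l with β (a.succAbove l) = β a, y l with hr
    have hr0 : 0 ≤ r := by have := hy.2 (β a); simp only [hr]; linarith
    have : (fun s : ℝ => G (a.insertNth s y)) =
        (Icc 0 r).indicator fun s => g (a.insertNth s y) := by
      funext s
      by_cases hs : s ∈ Icc 0 r
      · rw [indicator_of_mem hs, hG,
          indicator_of_mem ((insertNth_mem_refElem β a s y).2 ⟨hy, hs⟩)]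
      · rw [indicator_of_notMem hs, hG, indicator_of_notMem]
        exact fun h' => hs ((insertNth_mem_refElem β a s y).1 h').2
    rw [this, integral_indicator measurableSet_Icc, indicator_of_mem hy,
      integral_Icc_eq_integral_Ioc, ← intervalIntegral.integral_of_le hr0]
    refine intervalIntegral.integral_eq_sub_of_hasDerivAt
      (f := fun s => MvPolynomial.eval (a.insertNth s y : Vec (n + 1)) h) (fun s _ => ?_) ?_
    · have h1 := (hasStrictFDerivAt_eval h (a.insertNth s y)).hasFDerivAt
      have h2 : HasDerivAt (fun s : ℝ => (a.insertNth s y : Vec (n + 1))) (Pi.single a 1) s := by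
        rw [hasDerivAt_pi]
        intro i
        refine Fin.succAboveCases a ?_ (fun l => ?_) i
        · simpa only [Fin.insertNth_apply_same, Pi.single_eq_same] using hasDerivAt_id' s
        · simpa using hasDerivAt_const s (y l)
      refine (h1.comp_hasDerivAt s h2).congr_deriv ?_
      simp [hg, Pi.single_apply]
    · exact (hgc.comp (continuous_insertNth a continuous_id continuous_const)
        ).intervalIntegrable _ _
  · rw [indicator_of_notMem hy]
    refine (integral_congr_ae (Filter.Eventually.of_forall fun s => ?_)).trans (integral_zero' _ _)
    exact indicator_of_notMem (fun h' => hy ((insertNth_mem_refElem β a s y).1 h').1) _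

/-! ### The divergence theorem on a reference element -/

/-- An involution has determinant `±1`, so it preserves volume, and so does its composition with a
translation. -/
theorem measurePreserving_of_involutive {n : ℕ} (L : Vec n →ₗ[ℝ] Vec n) (hL : ∀ y, L (L y) = y)
    (c : Vec n) : MeasurePreserving (fun y => L y + c) (volume : Measure (Vec n)) volume := by
  have hd : LinearMap.det L * LinearMap.det L = 1 := by
    rw [← LinearMap.det_comp, show L ∘ₗ L = LinearMap.id from LinearMap.ext hL, LinearMap.det_id]
  have h0 : LinearMap.det L ≠ 0 := by
    intro h; rw [h] at hd; simp at hd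
  have h1 : |(LinearMap.det L)⁻¹| = 1 := by
    rcases mul_self_eq_one_iff.1 hd with h | h <;> simp [h]
  have hm : MeasurePreserving L (volume : Measure (Vec n)) volume := by
    refine ⟨L.continuous_of_finiteDimensional.measurable, ?_⟩
    rw [Measure.map_linearMap_addHaar_eq_smul_addHaar _ h0, h1]
    simp
  exact (measurePreserving_add_right volume c).comp hm

/-- The reflection of a simplex block that exchanges the coordinate `l` with the barycentric
coordinate `1 - ∑ y`. -/
def blockReflection {n : ℕ} (γ : Fin n → ℕ) (l : Fin n) (y : Vec n) : Vec n :=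
  Function.update y l (1 - ∑ m with γ m = γ l, y m)

theorem sum_update_block {n : ℕ} (γ : Fin n → ℕ) (l : Fin n) (y : Vec n) (s : ℝ) (b : ℕ) :
    ∑ m with γ m = b, Function.update y l s m =
      (if γ l = b then s - y l else 0) + ∑ m with γ m = b, y m := by
  split_ifs with h
  · rw [Finset.sum_update_of_mem (by simpa using h),
      ← Finset.add_sum_erase {m | γ m = b} y (by simpa using h : l ∈ _),
      Finset.sdiff_singleton_eq_erase]
    ring
  · rw [Finset.sum_update_of_notMem (by simpa using h), zero_add]

theorem blockReflection_involutive {n : ℕ} (γ : Fin n → ℕ) (l : Fin n) (y : Vec n) :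
    blockReflection γ l (blockReflection γ l y) = y := by
  funext m
  unfold blockReflection
  rw [sum_update_block, if_pos rfl, Function.update_idem]
  rcases eq_or_ne m l with rfl | h
  · rw [Function.update_self]; ring
  · simp [h]

theorem measurePreserving_blockReflection {n : ℕ} (γ : Fin n → ℕ) (l : Fin n) :
    MeasurePreserving (blockReflection γ l) (volume : Measure (Vec n)) volume := by
  -- The reflection is affine: `L` is its linear part, and the constant `1` in the coordinate `l` is
  -- the translation.
  let L : Vec n →ₗ[ℝ] Vec n :=
    { toFun := fun y => Function.update y l (-∑ m with γ m = γ l, y m)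
      map_add' := fun x y => by
        funext m
        rcases eq_or_ne m l with rfl | h
        · simp [Finset.sum_add_distrib]; ring
        · simp [h]
      map_smul' := fun c y => by
        funext m
        rcases eq_or_ne m l with rfl | h
        · simp [Finset.mul_sum]
        · simp [h] }
  have hL : ∀ y, L (L y) = y := fun y => by
    funext m
    simp only [L, LinearMap.coe_mk, AddHom.coe_mk]
    rw [sum_update_block, if_pos rfl, Function.update_idem]
    rcases eq_or_ne m l with rfl | h
    · simp
    · simp [h]
  convert measurePreserving_of_involutive L hL (Pi.single l 1) using 1
  funext y m
  rcases eq_or_ne m l with rfl | h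
  · simp [blockReflection, L]; ring
  · simp [blockReflection, L, h]

theorem blockReflection_mem {n : ℕ} {γ : Fin n → ℕ} {l : Fin n} {y : Vec n}
    (hy : y ∈ refElem γ) : blockReflection γ l y ∈ refElem γ := by
  refine ⟨fun m => ?_, fun b => ?_⟩
  · unfold blockReflection
    rcases eq_or_ne m l with rfl | h
    · simpa using hy.2 (γ m)
    · simpa [h] using hy.1 m
  · unfold blockReflection
    rw [sum_update_block]
    split_ifs with h
    · subst h
      have := hy.1 l
      linarith
    · simpa using hy.2 b

theorem integral_blockReflection {n : ℕ} (γ : Fin n → ℕ) (l : Fin n) (f : Vec n → ℝ) :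
    ∫ y in refElem γ, f (blockReflection γ l y) = ∫ y in refElem γ, f y := by
  let e : Vec n ≃ᵐ Vec n :=
    { toFun := blockReflection γ l
      invFun := blockReflection γ l
      left_inv := blockReflection_involutive γ l
      right_inv := blockReflection_involutive γ l
      measurable_toFun := (measurePreserving_blockReflection γ l).measurable
      measurable_invFun := (measurePreserving_blockReflection γ l).measurable }
  have hp : blockReflection γ l ⁻¹' refElem γ = refElem γ :=
    Subset.antisymm (fun y hy => blockReflection_involutive γ l y ▸ blockReflection_mem hy)
      fun y hy => blockReflection_mem hy
  have := (measurePreserving_blockReflection γ l).setIntegral_preimage_emb e.measurableEmbedding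
    f (refElem γ)
  rwa [hp] at this

theorem comp_equiv_mem_refElem {n : ℕ} {γ δ : Fin n → ℕ} (ρ : Fin n ≃ Fin n)
    (h : ∀ l, δ (ρ l) = γ l) (y : Vec n) : y ∘ ρ ∈ refElem γ ↔ y ∈ refElem δ := by
  have hs : ∀ b, ∑ l with γ l = b, (y ∘ ρ) l = ∑ l with δ l = b, y l := fun b => by
    simp only [Finset.sum_filter, ← h]
    exact Equiv.sum_comp ρ (fun l => if δ l = b then y l else 0)
  simp only [refElem, mem_ofPred_eq, hs]
  refine and_congr_left fun _ => ?_
  exact ρ.forall_congr_left.trans (by simp)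

theorem integral_comp_equiv_refElem {n : ℕ} {γ δ : Fin n → ℕ} (ρ : Fin n ≃ Fin n)
    (h : ∀ l, δ (ρ l) = γ l) (f : Vec n → ℝ) :
    ∫ y in refElem δ, f (y ∘ ρ) = ∫ y in refElem γ, f y := by
  have hm := volume_measurePreserving_piCongrLeft (fun _ : Fin n => ℝ) ρ.symm
  have he : ∀ y : Vec n, MeasurableEquiv.piCongrLeft (fun _ : Fin n => ℝ) ρ.symm y = y ∘ ρ := by
    intro y
    funext l
    have := Equiv.piCongrLeft_apply_apply (fun _ : Fin n => ℝ) ρ.symm y (ρ l)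
    simp only [Equiv.symm_apply_apply] at this
    exact this
  have := hm.setIntegral_preimage_emb (MeasurableEquiv.measurableEmbedding _) f (refElem γ)
  have hp : MeasurableEquiv.piCongrLeft (fun _ : Fin n => ℝ) ρ.symm ⁻¹' refElem γ = refElem δ := by
    ext y
    rw [mem_preimage, he, comp_equiv_mem_refElem ρ h]
  rw [hp] at this
  simpa only [he] using this

/-- The integral over an oblique facet does not depend on the coordinate that is eliminated. -/
theorem integral_obliqueFacet_eq {n : ℕ} (β : Fin (n + 1) → ℕ) {a i : Fin (n + 1)}
    (hai : β a = β i) (f : Vec (n + 1) → ℝ) :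
    ∫ y in refElem (fun l => β (a.succAbove l)),
        f (a.insertNth (1 - ∑ l with β (a.succAbove l) = β a, y l) y : Vec (n + 1)) =
      ∫ y in refElem (fun l => β (i.succAbove l)),
        f (i.insertNth (1 - ∑ l with β (i.succAbove l) = β i, y l) y : Vec (n + 1)) := by
  rcases eq_or_ne i a with rfl | hne
  · rfl
  obtain ⟨l₀, hl₀⟩ := Fin.exists_succAbove_eq hne
  set σ := Equiv.swap a i with hσ
  have hβσ : ∀ m, β (σ m) = β m := fun m => by
    rcases eq_or_ne m a with rfl | h1
    · simp [hσ, hai]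
    rcases eq_or_ne m i with rfl | h2
    · simp [hσ, hai]
    · rw [hσ, Equiv.swap_apply_of_ne_of_ne h1 h2]
  let ρ : Fin n ≃ Fin n := (finSuccAboveEquiv a).trans
    ((σ.subtypeEquiv (p := fun x => x ≠ a) (q := fun x => x ≠ i) fun m => by
      rw [not_iff_not]
      constructor
      · rintro rfl; simp [hσ]
      · intro h; rw [← σ.injective.eq_iff, h]; simp [hσ]).trans
      (finSuccAboveEquiv i).symm)
  have hρ : ∀ l, i.succAbove (ρ l) = σ (a.succAbove l) := fun l => by
    exact congrArg Subtype.val ((finSuccAboveEquiv i).apply_symm_apply _)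
  have hb : ∀ l, β (i.succAbove (ρ l)) = β (a.succAbove l) := fun l => by rw [hρ, hβσ]
  -- Here `l₀` is the position of `i` among the coordinates other than `a`. Reflecting in `l₀` puts
  -- the dependent value `1 - ∑ y` in the coordinate `i` and the free value `y l₀` in the coordinate
  -- `a`. The two parametrizations then differ only by the relabelling `ρ`, induced by the swap of
  -- `a` and `i`.
  rw [← integral_blockReflection (fun l => β (a.succAbove l)) l₀,
    ← integral_comp_equiv_refElem (γ := fun l => β (a.succAbove l))
      (δ := fun l => β (i.succAbove l)) ρ hb]
  congr 1
  funext y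
  congr 1
  have hsum : ∑ l with β (a.succAbove l) = β a, (y ∘ ρ) l =
      ∑ l with β (i.succAbove l) = β i, y l := by
    simp only [Finset.sum_filter, ← hb, hai]
    exact Equiv.sum_comp ρ (fun l => if β (i.succAbove l) = β i then y l else 0)
  have hγ : β (a.succAbove l₀) = β a := by rw [hl₀, hai]
  have hl : ∀ m, m ≠ l₀ → i.succAbove (ρ m) = a.succAbove m := fun m hm => by
    rw [hρ, hσ, Equiv.swap_apply_of_ne_of_ne (Fin.succAbove_ne a m)]
    rw [← hl₀]
    exact fun h => hm (Fin.succAbove_right_injective h)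
  have hl' : i.succAbove (ρ l₀) = a := by rw [hρ, hl₀, hσ, Equiv.swap_apply_right]
  funext m
  refine Fin.succAboveCases a ?_ (fun l => ?_) m
  · rw [Fin.insertNth_apply_same]
    unfold blockReflection
    rw [sum_update_block, if_pos hγ]
    simp only [hγ]
    conv_rhs => rw [← hl', Fin.insertNth_apply_succAbove]
    simp only [Function.comp_apply]
    ring
  · rw [Fin.insertNth_apply_succAbove]
    unfold blockReflection
    rcases eq_or_ne l l₀ with rfl | h
    · rw [Function.update_self, hl₀, Fin.insertNth_apply_same]
      simp only [hl₀, ← hai]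
      rw [hsum, hai]
    · rw [Function.update_of_ne h, ← hl l h, Fin.insertNth_apply_succAbove]
      rfl

/-- The divergence theorem on a reference element, for one component of a polynomial field. -/
theorem integral_refElem_pderiv_eq_sum_facets {n : ℕ} (β : Fin (n + 1) → ℕ) (a : Fin (n + 1))
    (h : MvPolynomial (Fin (n + 1)) ℝ) :
    ∫ ξ in refElem β, MvPolynomial.eval ξ (MvPolynomial.pderiv a h) =
      ∑ j : Facet β, ∫ y in facetDomain j,
        MvPolynomial.eval (facetMap j y) h * facetAreaVec j a := by
  rw [integral_refElem_pderiv, Fintype.sum_sum_type]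
  have h1 : ∑ i : Fin (n + 1), ∫ y in facetDomain (β := β) (Sum.inl i),
      MvPolynomial.eval (facetMap (β := β) (Sum.inl i) y) h * facetAreaVec (β := β) (Sum.inl i) a =
      -∫ y in refElem (fun l => β (a.succAbove l)),
        MvPolynomial.eval (a.insertNth 0 y : Vec (n + 1)) h := by
    rw [Finset.sum_eq_single a]
    · rw [integral_mul_const]
      simp [facetDomain, facetMap, facetAreaVec, facetIndex]
    · intro i _ hi
      rw [integral_mul_const]
      simp [facetAreaVec, hi.symm]
    · simp
  -- Oblique facets are indexed by the first coordinate `i` of a block. The one of the block of `a`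
  -- is the only one whose area vector has a component along `a`, and it must be reparametrized from
  -- eliminating `a` to eliminating `i`.
  obtain ⟨i, hi, hmin⟩ : ∃ i, β a = β i ∧ ∀ j, β j = β i → i ≤ j := by
    have hne : (Finset.univ.filter fun j => β j = β a).Nonempty := ⟨a, by simp⟩
    refine ⟨Finset.min' _ hne, ?_, fun j hj => Finset.min'_le _ _ ?_⟩
    · have := Finset.min'_mem _ hne
      simpa [eq_comm] using this
    · have := Finset.min'_mem _ hne
      simp only [Finset.mem_filter, Finset.mem_univ, true_and] at this ⊢
      rw [hj, this]
  have h2 : ∑ i : {i : Fin (n + 1) // ∀ j, β j = β i → i ≤ j},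
      ∫ y in facetDomain (β := β) (Sum.inr i),
      MvPolynomial.eval (facetMap (β := β) (Sum.inr i) y) h * facetAreaVec (β := β) (Sum.inr i) a =
      ∫ y in refElem (fun l => β (a.succAbove l)), MvPolynomial.eval
        (a.insertNth (1 - ∑ l with β (a.succAbove l) = β a, y l) y : Vec (n + 1)) h := by
    rw [Finset.sum_eq_single ⟨i, hmin⟩]
    · rw [integral_mul_const, integral_obliqueFacet_eq β hi (fun ξ => MvPolynomial.eval ξ h)]
      simp [facetDomain, facetMap, facetAreaVec, facetIndex, hi]
    · intro i' _ hi'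
      rw [integral_mul_const]
      have : β a ≠ β i' := fun h => hi' (Subtype.ext
        (le_antisymm (i'.2 _ (by rw [← hi, h])) (hmin _ (by rw [← hi, h]))))
      simp [facetAreaVec, this]
    · simp
  rw [h1, h2]
  ring

/-! ### The Piola identity -/

/-- The product rule is phrased with `Function.update` so that, inside the Leibniz expansion of a
determinant, each term is a term of the determinant with one column differentiated. -/
theorem derivation_prod {R A ι : Type*} [CommRing R] [CommRing A] [Algebra R A] [DecidableEq ι]
    (D : Derivation R A A) (s : Finset ι) (f : ι → A) :
    D (∏ i ∈ s, f i) = ∑ i ∈ s, ∏ k ∈ s, Function.update f i (D (f i)) k := by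
  induction s using Finset.induction_on with
  | empty => simp
  | insert a s ha ih =>
    rw [Finset.prod_insert ha, D.leibniz, ih, Finset.sum_insert ha, Finset.prod_insert ha,
      Function.update_self, smul_eq_mul, smul_eq_mul, Finset.mul_sum, add_comm, mul_comm]
    congr 1
    · congr 1
      refine Finset.prod_congr rfl fun k hk => ?_
      rw [Function.update_of_ne (ne_of_mem_of_not_mem hk ha)]
    · refine Finset.sum_congr rfl fun i hi => ?_
      rw [Finset.prod_insert ha, Function.update_of_ne (ne_of_mem_of_not_mem hi ha).symm]

/-- Jacobi's formula for the derivative of a determinant. -/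
theorem derivation_det {R A ι : Type*} [CommRing R] [CommRing A] [Algebra R A] [Fintype ι]
    [DecidableEq ι] (D : Derivation R A A) (M : Matrix ι ι A) :
    D M.det = ∑ i, ∑ j, M.adjugate i j * D (M j i) := by
  -- By Cramer's rule the inner sum is the determinant with column `i` differentiated, which can be
  -- compared with the Leibniz expansion term by term.
  have h : ∀ i, ∑ j, M.adjugate i j * D (M j i) = (M.updateCol i fun j => D (M j i)).det := fun i => by
    rw [← Matrix.cramer_apply, Matrix.cramer_eq_adjugate_mulVec]
    rfl
  simp only [h, Matrix.det_apply, map_sum]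
  rw [Finset.sum_comm]
  refine Finset.sum_congr rfl fun σ _ => ?_
  rw [Units.smul_def, map_zsmul, derivation_prod, Finset.smul_sum]
  refine Finset.sum_congr rfl fun i _ => ?_
  congr 1
  refine Finset.prod_congr rfl fun k _ => ?_
  rcases eq_or_ne k i with rfl | hk
  · simp
  · simp [hk]

/-- The commutator of two derivations is a derivation, and this one vanishes on the variables. -/
theorem pderiv_comm {σ R : Type*} [CommRing R] (i j : σ) (q : MvPolynomial σ R) :
    MvPolynomial.pderiv i (MvPolynomial.pderiv j q) =
      MvPolynomial.pderiv j (MvPolynomial.pderiv i q) := by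
  have h : ⁅(MvPolynomial.pderiv i : Derivation R (MvPolynomial σ R) (MvPolynomial σ R)),
      (MvPolynomial.pderiv j : Derivation R (MvPolynomial σ R) (MvPolynomial σ R))⁆ = 0 := by
    classical
    refine MvPolynomial.derivation_ext fun k => ?_
    rw [Derivation.commutator_apply, MvPolynomial.pderiv_X, MvPolynomial.pderiv_X]
    simp [Pi.single_apply, apply_ite]
  have := congrArg (fun D => D q) h
  simpa [Derivation.commutator_apply, sub_eq_zero] using this

/-- The Jacobian matrix of a polynomial map, as a matrix of polynomials. -/
def jacPoly {d : ℕ} (q : Fin d → MvPolynomial (Fin d) ℝ) :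
    Matrix (Fin d) (Fin d) (MvPolynomial (Fin d) ℝ) :=
  Matrix.of fun i j => MvPolynomial.pderiv j (q i)

theorem polyJac_eq_map {d : ℕ} (q : Fin d → MvPolynomial (Fin d) ℝ) (ξ : Vec d) :
    polyJac q ξ = (MvPolynomial.eval ξ).mapMatrix (jacPoly q) := rfl

theorem eval_jacPoly_det {d : ℕ} (q : Fin d → MvPolynomial (Fin d) ℝ) (ξ : Vec d) :
    MvPolynomial.eval ξ (jacPoly q).det = (polyJac q ξ).det := by
  rw [polyJac_eq_map, RingHom.map_det]

theorem eval_jacPoly_adjugate {d : ℕ} (q : Fin d → MvPolynomial (Fin d) ℝ) (ξ : Vec d)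
    (i j : Fin d) :
    MvPolynomial.eval ξ ((jacPoly q).adjugate i j) = (polyJac q ξ).adjugate i j := by
  rw [polyJac_eq_map, ← RingHom.map_adjugate]
  rfl

/-- The columns of the adjugate of a Jacobian matrix are divergence free. -/
theorem sum_pderiv_adjugate_eq_zero {d : ℕ} (q : Fin d → MvPolynomial (Fin d) ℝ)
    (hq : (jacPoly q).det ≠ 0) (j : Fin d) :
    ∑ a, MvPolynomial.pderiv a ((jacPoly q).adjugate a j) = 0 := by
  set J := jacPoly q with hJ
  set D : Fin d → MvPolynomial (Fin d) ℝ :=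
    fun j => ∑ a, MvPolynomial.pderiv a (J.adjugate a j) with hD
  -- Apply `∑ₐ ∂ₐ` to column `b` of `adj J * J = det J • 1`. The right side gives `∂_b det J`. On
  -- the left the product rule gives `(D J)_b` and, since second derivatives commute, `∑ adj J · ∂_b
  -- J`. The latter is again `∂_b det J` by Jacobi's formula.
  have key : Matrix.vecMul D J = 0 := by
    funext b
    have h1 : ∑ a, MvPolynomial.pderiv a ((J.adjugate * J) a b) = MvPolynomial.pderiv b J.det := by
      rw [Matrix.adjugate_mul, Finset.sum_eq_single b]
      · simp
      · intro a _ hab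
        simp [hab]
      · simp
    rw [derivation_det] at h1
    have h2 : ∑ a, MvPolynomial.pderiv a ((J.adjugate * J) a b) =
        Matrix.vecMul D J b + ∑ i, ∑ k, J.adjugate i k * MvPolynomial.pderiv b (J k i) := by
      have h3 : ∀ a, MvPolynomial.pderiv a ((J.adjugate * J) a b) =
          ∑ k, MvPolynomial.pderiv a (J.adjugate a k) * J k b +
            ∑ k, J.adjugate a k * MvPolynomial.pderiv b (J k a) := fun a => by
        rw [Matrix.mul_apply, map_sum, ← Finset.sum_add_distrib]
        refine Finset.sum_congr rfl fun k _ => ?_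
        rw [MvPolynomial.pderiv_mul]
        congr 2
        exact pderiv_comm a b _
      rw [Finset.sum_congr rfl fun a _ => h3 a, Finset.sum_add_distrib]
      congr 1
      rw [Finset.sum_comm]
      exact Finset.sum_congr rfl fun k _ => (Finset.sum_mul _ _ _).symm
    rw [h2] at h1
    exact add_eq_right.1 h1
  -- Multiplying by the adjugate gives `det J • D = 0`. Polynomials form an integral domain, so a
  -- nonzero `det J` can be cancelled without being invertible.
  have h3 : J.det • D = 0 := by
    have : Matrix.vecMul D (J * J.adjugate) = 0 := by
      rw [← Matrix.vecMul_vecMul, key, Matrix.zero_vecMul]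
    rwa [Matrix.mul_adjugate, Matrix.vecMul_smul, Matrix.vecMul_one] at this
  exact (mul_eq_zero.1 (congrFun h3 j)).resolve_left hq

/-! ### Integration over curved elements -/

/-- Continuity descends along a continuous image of a compact set. -/
theorem continuousOn_image_of_comp {X Y Z : Type*} [TopologicalSpace X] [TopologicalSpace Y]
    [T2Space Y] [TopologicalSpace Z] {s : Set X} (hs : IsCompact s) {φ : X → Y}
    (hφ : ContinuousOn φ s) {g : Y → Z} (hg : ContinuousOn (fun x => g (φ x)) s) :
    ContinuousOn g (φ '' s) := by
  have : CompactSpace s := isCompact_iff_compactSpace.1 hs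
  let r : s → φ '' s := (mapsTo_image φ s).restrict φ s (φ '' s)
  have hr : Continuous r := hφ.mapsToRestrict (mapsTo_image φ s)
  have hq : Topology.IsQuotientMap r :=
    hr.isClosedMap.isQuotientMap hr (surjective_mapsTo_image_restrict φ s)
  rw [continuousOn_iff_continuous_domRestrict, hq.continuous_iff]
  exact continuousOn_iff_continuous_domRestrict.1 hg

theorem sign_mul_self_eq_abs (r : ℝ) : Real.sign r * r = |r| := by
  rcases lt_trichotomy r 0 with h | rfl | h
  · rw [Real.sign_of_neg h, abs_of_neg h]; ring
  · simp
  · rw [Real.sign_of_pos h, abs_of_pos h]; ring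

namespace Mesh

variable {n p : ℕ} {Ω : Set (Vec (n + 1))} (M : Mesh n p Ω)

/-- The scalar field `g` on the closed element `K` pulls back to the polynomial `q`. -/
def PullsBack (K : M.Elem) (g : Vec (n + 1) → ℝ) (q : MvPolynomial (Fin (n + 1)) ℝ) : Prop :=
  ∀ ξ ∈ refElem (M.elemRef K), g (M.elemMap K ξ) = MvPolynomial.eval ξ q

variable {M} in
theorem PullsBack.mul {K : M.Elem} {g w : Vec (n + 1) → ℝ} {q r : MvPolynomial (Fin (n + 1)) ℝ}
    (hg : M.PullsBack K g q) (hw : M.PullsBack K w r) :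
    M.PullsBack K (fun x => g x * w x) (q * r) := fun ξ hξ => by
  rw [map_mul, ← hg ξ hξ, ← hw ξ hξ]

theorem continuous_elemMap (K : M.Elem) : Continuous (M.elemMap K) := continuous_polyMap _

theorem isCompact_closedElem (K : M.Elem) : IsCompact (M.closedElem K) :=
  (isCompact_refElem _).image (M.continuous_elemMap K)

theorem elemSet_subset_closedElem (K : M.Elem) : M.elemSet K ⊆ M.closedElem K :=
  image_mono interior_subset

variable {M} in
theorem PullsBack.continuousOn {K : M.Elem} {g : Vec (n + 1) → ℝ}
    {q : MvPolynomial (Fin (n + 1)) ℝ} (hg : M.PullsBack K g q) :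
    ContinuousOn g (M.closedElem K) :=
  continuousOn_image_of_comp (isCompact_refElem _) (M.continuous_elemMap K).continuousOn
    ((MvPolynomial.continuous_eval q).continuousOn.congr hg)

theorem hasStrictFDerivAt_elemMap (K : M.Elem) (ξ : Vec (n + 1)) :
    HasStrictFDerivAt (M.elemMap K)
      (Matrix.toLin' (polyJac (M.elemPoly K) ξ)).toContinuousLinearMap ξ :=
  hasStrictFDerivAt_polyMap _ _

theorem det_toLin'_polyJac (K : M.Elem) (ξ : Vec (n + 1)) :
    (Matrix.toLin' (polyJac (M.elemPoly K) ξ)).toContinuousLinearMap.det =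
      (polyJac (M.elemPoly K) ξ).det := by
  rw [LinearMap.det_toContinuousLinearMap, LinearMap.det_toLin']

theorem measurableSet_elemSet (K : M.Elem) : MeasurableSet (M.elemSet K) :=
  measurable_image_of_fderivWithin isOpen_interior.measurableSet
    (fun ξ _ => (M.hasStrictFDerivAt_elemMap K ξ).hasFDerivAt.hasFDerivWithinAt)
    ((M.elemPoly_injOn K).mono interior_subset)

variable {M} in
-- The Jacobian is invertible, so by the inverse function theorem `g` is, near an interior point, a
-- polynomial composed with a differentiable local inverse of the element mapping.
theorem PullsBack.differentiableAt {K : M.Elem} {g : Vec (n + 1) → ℝ}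
    {q : MvPolynomial (Fin (n + 1)) ℝ} (hg : M.PullsBack K g q) {ξ : Vec (n + 1)}
    (hξ : ξ ∈ interior (refElem (M.elemRef K))) : DifferentiableAt ℝ g (M.elemMap K ξ) := by
  have hdet : (Matrix.toLin' (polyJac (M.elemPoly K) ξ)).toContinuousLinearMap.det ≠ 0 := by
    rw [det_toLin'_polyJac]
    exact M.elemPoly_det K ξ (interior_subset hξ)
  have hs : HasStrictFDerivAt (M.elemMap K)
      (((Matrix.toLin' (polyJac (M.elemPoly K) ξ)).toContinuousLinearMap.toContinuousLinearEquivOfDetNeZero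
        hdet : Vec (n + 1) ≃L[ℝ] Vec (n + 1)) : Vec (n + 1) →L[ℝ] Vec (n + 1)) ξ := by
    rw [ContinuousLinearMap.coe_toContinuousLinearEquivOfDetNeZero]
    exact M.hasStrictFDerivAt_elemMap K ξ
  have hinv := hs.to_localInverse
  have hcont := hs.localInverse_continuousAt
  have himg : hs.localInverse _ _ _ (M.elemMap K ξ) = ξ := hs.localInverse_apply_image
  have hev : ∀ᶠ x in nhds (M.elemMap K ξ),
      g x = MvPolynomial.eval (hs.localInverse _ _ _ x) q := by
    have h1 : ∀ᶠ x in nhds (M.elemMap K ξ),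
        hs.localInverse _ _ _ x ∈ interior (refElem (M.elemRef K)) :=
      hcont.eventually_mem (by rw [himg]; exact isOpen_interior.mem_nhds hξ)
    filter_upwards [h1, hs.eventually_right_inverse] with x hx hx'
    rw [← hg _ (interior_subset hx), hx']
  refine DifferentiableAt.congr_of_eventuallyEq ?_ hev
  exact DifferentiableAt.comp (g := fun ξ => MvPolynomial.eval ξ q) (M.elemMap K ξ)
    (hasStrictFDerivAt_eval q _).hasFDerivAt.differentiableAt hinv.hasFDerivAt.differentiableAt

variable {M} in
/-- The chain rule, solved for the physical derivatives. -/
theorem PullsBack.det_mul_fderiv {K : M.Elem} {g : Vec (n + 1) → ℝ}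
    {q : MvPolynomial (Fin (n + 1)) ℝ} (hg : M.PullsBack K g q) {ξ : Vec (n + 1)}
    (hξ : ξ ∈ interior (refElem (M.elemRef K))) (j : Fin (n + 1)) :
    (polyJac (M.elemPoly K) ξ).det * fderiv ℝ g (M.elemMap K ξ) (Pi.single j 1) =
      ∑ a, MvPolynomial.eval ξ (MvPolynomial.pderiv a q) *
        (polyJac (M.elemPoly K) ξ).adjugate a j := by
  set J := polyJac (M.elemPoly K) ξ with hJ
  have h1 := (hg.differentiableAt hξ).hasFDerivAt.comp ξ (M.hasStrictFDerivAt_elemMap K ξ).hasFDerivAt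
  have h2 : HasFDerivAt (g ∘ M.elemMap K) _ ξ :=
    (hasStrictFDerivAt_eval q ξ).hasFDerivAt.congr_of_eventuallyEq
      (Filter.eventually_of_mem (isOpen_interior.mem_nhds hξ)
        fun ζ hζ => hg ζ (interior_subset hζ))
  -- The derivative of the pullback is computed once by the chain rule and once from the polynomial.
  -- Comparing them along the basis vectors gives `∇q = Jᵀ ∇g`, which `J * adj J = det J • 1` then
  -- solves without dividing by the determinant.
  have h3 := h1.unique h2
  have h4 : ∀ a, MvPolynomial.eval ξ (MvPolynomial.pderiv a q) =
      ∑ i, fderiv ℝ g (M.elemMap K ξ) (Pi.single i 1) * J i a := fun a => by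
    have h5 := DFunLike.congr_fun h3 (Pi.single a 1)
    simp only [ContinuousLinearMap.comp_apply, LinearMap.coe_toContinuousLinearMap',
      Matrix.toLin'_apply, Matrix.mulVec_single_one, sum_apply,
      smul_apply, ContinuousLinearMap.proj_apply, smul_eq_mul,
      Pi.single_apply, mul_ite, mul_one, mul_zero, Finset.sum_ite_eq', Finset.mem_univ,
      if_true, ← hJ] at h5
    rw [← h5, pi_eq_sum_univ' (J.col a), map_sum]
    refine Finset.sum_congr rfl fun i _ => ?_
    rw [map_smul, smul_eq_mul, mul_comm]
    rfl
  simp only [h4, Finset.sum_mul]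
  rw [Finset.sum_comm]
  have h6 : ∀ i, ∑ a, fderiv ℝ g (M.elemMap K ξ) (Pi.single i 1) * J i a * J.adjugate a j =
      fderiv ℝ g (M.elemMap K ξ) (Pi.single i 1) * (J * J.adjugate) i j := fun i => by
    rw [Matrix.mul_apply, Finset.mul_sum]
    exact Finset.sum_congr rfl fun a _ => mul_assoc _ _ _
  simp only [h6, Matrix.mul_adjugate, Matrix.smul_apply, Matrix.one_apply, smul_eq_mul, mul_ite,
    mul_one, mul_zero, Finset.sum_ite_eq', Finset.mem_univ, if_true]
  exact mul_comm _ _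

theorem jacPoly_det_ne_zero (K : M.Elem) : (jacPoly (M.elemPoly K)).det ≠ 0 := by
  intro h
  refine M.elemPoly_det K 0 (zero_mem_refElem _) ?_
  rw [← eval_jacPoly_det, h, map_zero]

theorem continuous_det (K : M.Elem) : Continuous fun ξ => (polyJac (M.elemPoly K) ξ).det := by
  simp only [← eval_jacPoly_det]
  exact MvPolynomial.continuous_eval _

/-- The element mapping has constant orientation. -/
theorem sign_det (K : M.Elem) {ξ : Vec (n + 1)} (hξ : ξ ∈ refElem (M.elemRef K)) :
    Real.sign (polyJac (M.elemPoly K) ξ).det = Real.sign (polyJac (M.elemPoly K) 0).det := by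
  have hc := (M.continuous_det K).continuousOn (s := refElem (M.elemRef K))
  have hp := (convex_refElem (M.elemRef K)).isPreconnected
  have h0 := zero_mem_refElem (M.elemRef K)
  have hne := M.elemPoly_det K
  rcases lt_or_gt_of_ne (hne ξ hξ) with h1 | h1 <;> rcases lt_or_gt_of_ne (hne 0 h0) with h2 | h2
  · rw [Real.sign_of_neg h1, Real.sign_of_neg h2]
  · obtain ⟨ζ, hζ, hζ'⟩ := hp.intermediate_value hξ h0 hc ⟨h1.le, h2.le⟩
    exact absurd hζ' (hne ζ hζ)
  · obtain ⟨ζ, hζ, hζ'⟩ := hp.intermediate_value h0 hξ hc ⟨h2.le, h1.le⟩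
    exact absurd hζ' (hne ζ hζ)
  · rw [Real.sign_of_pos h1, Real.sign_of_pos h2]

/-- The absolute value in the change of variables is replaced by a constant sign, read off at the
vertex `0`. What stays under the integral is the determinant itself, a polynomial to which the Piola
identity applies. -/
theorem setIntegral_elemSet (K : M.Elem) (g : Vec (n + 1) → ℝ) :
    ∫ x in M.elemSet K, g x = Real.sign (polyJac (M.elemPoly K) 0).det *
      ∫ ξ in interior (refElem (M.elemRef K)),
        (polyJac (M.elemPoly K) ξ).det * g (M.elemMap K ξ) := by
  unfold elemSet
  rw [integral_image_eq_integral_abs_det_fderiv_smul volume isOpen_interior.measurableSet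
    (fun ξ _ => (M.hasStrictFDerivAt_elemMap K ξ).hasFDerivAt.hasFDerivWithinAt)
    ((M.elemPoly_injOn K).mono interior_subset), ← integral_const_mul]
  refine setIntegral_congr_fun isOpen_interior.measurableSet fun ξ hξ => ?_
  simp only [det_toLin'_polyJac, smul_eq_mul]
  rw [← M.sign_det K (interior_subset hξ), ← mul_assoc, sign_mul_self_eq_abs]

variable {M} in
-- After the change of variables, the Jacobian factor turns the physical derivative into a
-- polynomial expression in the adjugate, which is bounded on the reference element.
theorem PullsBack.integrableOn_mul_fderiv {K : M.Elem} {g w : Vec (n + 1) → ℝ}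
    {q r : MvPolynomial (Fin (n + 1)) ℝ} (hg : M.PullsBack K g q) (hw : M.PullsBack K w r)
    (j : Fin (n + 1)) :
    IntegrableOn (fun x => w x * fderiv ℝ g x (Pi.single j 1)) (M.elemSet K) := by
  unfold elemSet
  rw [integrableOn_image_iff_integrableOn_abs_det_fderiv_smul volume isOpen_interior.measurableSet
    (fun ξ _ => (M.hasStrictFDerivAt_elemMap K ξ).hasFDerivAt.hasFDerivWithinAt)
    ((M.elemPoly_injOn K).mono interior_subset)]
  have hc : Continuous fun ξ => Real.sign (polyJac (M.elemPoly K) 0).det *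
      MvPolynomial.eval ξ (r * ∑ a, MvPolynomial.pderiv a q *
        (jacPoly (M.elemPoly K)).adjugate a j) :=
    continuous_const.mul (MvPolynomial.continuous_eval _)
  refine ((hc.continuousOn.integrableOn_compact (isCompact_refElem (M.elemRef K))).mono_set
    interior_subset).congr_fun (fun ξ hξ => ?_) isOpen_interior.measurableSet
  simp only [det_toLin'_polyJac, smul_eq_mul, map_mul, map_sum, eval_jacPoly_adjugate]
  rw [← hg.det_mul_fderiv hξ, ← hw ξ (interior_subset hξ), ← M.sign_det K (interior_subset hξ),
    ← sign_mul_self_eq_abs]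
  ring

theorem continuous_areaVec (K : M.Elem) (j : Facet (M.elemRef K)) (i : Fin (n + 1)) :
    Continuous fun y => M.areaVec K j y i := by
  simp only [areaVec, Matrix.mulVec, dotProduct, Matrix.transpose_apply, facetJac,
    ← eval_jacPoly_adjugate]
  exact continuous_finsetSum _ fun a _ => ((MvPolynomial.continuous_eval _).comp
    (continuous_facetMap j)).mul continuous_const

theorem continuous_areaElement (K : M.Elem) (j : Facet (M.elemRef K)) :
    Continuous (M.areaElement K j) :=
  Real.continuous_sqrt.comp (continuous_finsetSum _ fun i _ =>
    (M.continuous_areaVec K j i).mul (M.continuous_areaVec K j i))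

theorem areaElement_nonneg (K : M.Elem) (j : Facet (M.elemRef K)) (y : Vec n) :
    0 ≤ M.areaElement K j y := Real.sqrt_nonneg _

/-- Where the area element vanishes the area vector vanishes as well, so the identity holds there
too and nondegeneracy of the parametrized facet need not be proved. -/
theorem areaElement_mul_normal (K : M.Elem) (j : Facet (M.elemRef K)) {y : Vec n}
    (hy : y ∈ facetDomain j) (i : Fin (n + 1)) :
    M.areaElement K j y * M.normal K j y i =
      Real.sign (polyJac (M.elemPoly K) 0).det * M.areaVec K j y i := by
  rw [← M.sign_det K (facetMap_mem_refElem j hy)]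
  simp only [normal, Pi.smul_apply, smul_eq_mul, facetJac]
  by_cases h : M.areaElement K j y = 0
  · have h0 : M.areaVec K j y = 0 := by
      rw [areaElement, Real.sqrt_eq_zero (show 0 ≤ M.areaVec K j y ⬝ᵥ M.areaVec K j y from
        Finset.sum_nonneg fun i _ => mul_self_nonneg _)] at h
      exact dotProduct_self_eq_zero.1 h
    simp [h0]
  · field_simp

theorem integral_facetMeasure (K : M.Elem) (j : Facet (M.elemRef K)) (g : Vec n → ℝ) :
    ∫ y, g y ∂(M.facetMeasure K j) = ∫ y in facetDomain j, M.areaElement K j y * g y := by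
  rw [facetMeasure, integral_withDensity_eq_integral_toReal_smul
    (M.continuous_areaElement K j).measurable.ennreal_ofReal (by simp)]
  simp only [ENNReal.toReal_ofReal (M.areaElement_nonneg K j _), smul_eq_mul]

variable {M} in
/-- The divergence theorem on a curved element, for one component of a polynomial field. -/
theorem PullsBack.integral_fderiv {K : M.Elem} {g : Vec (n + 1) → ℝ}
    {q : MvPolynomial (Fin (n + 1)) ℝ} (hg : M.PullsBack K g q) (i : Fin (n + 1)) :
    ∫ x in M.elemSet K, fderiv ℝ g x (Pi.single i 1) =
      ∑ j : Facet (M.elemRef K),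
        ∫ y, g (M.facetPoint K j y) * M.normal K j y i ∂(M.facetMeasure K j) := by
  rw [setIntegral_elemSet]
  set A := (jacPoly (M.elemPoly K)).adjugate with hA
  -- By the chain rule the integrand is `∑ₐ (∂ₐ q) A a i`. Moving the derivative in front of the
  -- product costs `q ∑ₐ ∂ₐ (A a i)`, which is zero by the Piola identity.
  have h1 : ∫ ξ in interior (refElem (M.elemRef K)),
      (polyJac (M.elemPoly K) ξ).det * fderiv ℝ g (M.elemMap K ξ) (Pi.single i 1) =
      ∑ a, ∫ ξ in refElem (M.elemRef K),
        MvPolynomial.eval ξ (MvPolynomial.pderiv a (q * A a i)) := by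
    rw [← integral_finsetSum _ fun a _ => (MvPolynomial.continuous_eval _).continuousOn.integrableOn_compact
      (isCompact_refElem _), ← setIntegral_congr_set (interior_refElem_ae_eq (M.elemRef K))]
    refine setIntegral_congr_fun isOpen_interior.measurableSet fun ξ hξ => ?_
    simp only [hg.det_mul_fderiv hξ, ← eval_jacPoly_adjugate, MvPolynomial.pderiv_mul, map_add,
      Finset.sum_add_distrib]
    have h2 : ∑ a, MvPolynomial.eval ξ (q * MvPolynomial.pderiv a (A a i)) = 0 := by
      rw [← map_sum, ← Finset.mul_sum, sum_pderiv_adjugate_eq_zero _ (M.jacPoly_det_ne_zero K),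
        mul_zero, map_zero]
    rw [h2, add_zero]
    simp only [map_mul, hA]
  rw [h1]
  simp only [integral_refElem_pderiv_eq_sum_facets]
  rw [Finset.sum_comm, Finset.mul_sum]
  refine Finset.sum_congr rfl fun j _ => ?_
  have hd : MeasurableSet (facetDomain j) := (isClosed_refElem _).measurableSet
  have hcont : ∀ a, Continuous fun y : Vec n =>
      MvPolynomial.eval (facetMap j y) (q * A a i) * facetAreaVec j a := fun a =>
    ((MvPolynomial.continuous_eval _).comp (continuous_facetMap j)).mul continuous_const
  have hint : ∀ a ∈ Finset.univ, Integrable (fun y : Vec n =>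
      MvPolynomial.eval (facetMap j y) (q * A a i) * facetAreaVec j a)
      (volume.restrict (facetDomain j)) := fun a _ =>
    (hcont a).continuousOn.integrableOn_compact (isCompact_refElem _)
  -- The adjugate applied to the reference area vector is the area vector of the curved facet. The
  -- orientation sign from the change of variables is the one that makes the normal outward.
  rw [integral_facetMeasure, ← integral_finsetSum _ hint, ← integral_const_mul]
  refine setIntegral_congr_fun hd fun y hy => ?_
  rw [mul_left_comm, M.areaElement_mul_normal K j hy i, facetPoint,
    hg _ (facetMap_mem_refElem j hy)]
  simp only [areaVec, Matrix.mulVec, dotProduct, Matrix.transpose_apply, facetJac, map_mul,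
    ← eval_jacPoly_adjugate, Finset.mul_sum, hA]
  exact Finset.sum_congr rfl fun a _ => by ring

variable {M} in
/-- Integration by parts on a curved element. -/
theorem PullsBack.integral_by_parts {K : M.Elem} {g w : Vec (n + 1) → ℝ}
    {q r : MvPolynomial (Fin (n + 1)) ℝ} (hg : M.PullsBack K g q) (hw : M.PullsBack K w r)
    (i : Fin (n + 1)) :
    (∫ x in M.elemSet K, w x * fderiv ℝ g x (Pi.single i 1)) +
        ∫ x in M.elemSet K, g x * fderiv ℝ w x (Pi.single i 1) =
      ∑ j : Facet (M.elemRef K), ∫ y, g (M.facetPoint K j y) * w (M.facetPoint K j y) *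
        M.normal K j y i ∂(M.facetMeasure K j) := by
  rw [← (hg.mul hw).integral_fderiv i,
    ← integral_add (hg.integrableOn_mul_fderiv hw i) (hw.integrableOn_mul_fderiv hg i)]
  refine setIntegral_congr_fun (M.measurableSet_elemSet K) ?_
  rintro _ ⟨ξ, hξ, rfl⟩
  have := ((hg.differentiableAt hξ).hasFDerivAt.mul (hw.differentiableAt hξ).hasFDerivAt).fderiv
  have h' : fderiv ℝ (fun x => g x * w x) (M.elemMap K ξ) = _ := this
  simp only [h', add_apply, smul_apply, smul_eq_mul]
  ring

end Mesh

/-! ### Bounded functions on finite measures -/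

/-- The exponent is free because discrete fields are bounded on facets while the traction is only
square integrable. -/
theorem memLp_dotProduct {α : Type*} [MeasurableSpace α] {μ : Measure α} {d : ℕ} {f g : α → Vec d}
    {p : ENNReal} (hf : MemLp f ⊤ μ) (hg : MemLp g p μ) : MemLp (fun y => f y ⬝ᵥ g y) p μ :=
  memLp_finsetSum _ fun i _ => (hg.eval i).mul' (hf.eval i)

theorem memLp_mulVec {α : Type*} [MeasurableSpace α] {μ : Measure α} {d : ℕ} {A : α → Mat d}
    {g : α → Vec d} (hA : MemLp A ⊤ μ) (hg : MemLp g ⊤ μ) :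
    MemLp (fun y => (A y).mulVec (g y)) ⊤ μ :=
  memLp_pi_iff.2 fun i => memLp_dotProduct (f := fun y => A y i)
    ((memLp_pi_iff (E := fun _ : Fin d => Vec d) (f := A)).1 hA i) hg

theorem memLp_top_of_continuousOn {X E : Type*} [TopologicalSpace X]
    [MeasurableSpace X] [OpensMeasurableSpace X] [NormedAddCommGroup E]
    [SecondCountableTopologyEither X E] {s : Set X} (hs : IsCompact s)
    (hm : MeasurableSet s) (μ : Measure X) {g : X → E} (hg : ContinuousOn g s) :
    MemLp g ⊤ (μ.restrict s) := by
  obtain ⟨C, hC⟩ := hs.exists_bound_of_continuousOn hg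
  exact memLp_top_of_bound (hg.aestronglyMeasurable hm) C
    ((ae_restrict_mem hm).mono fun x hx => hC x hx)

namespace Mesh

variable {n p : ℕ} {Ω : Set (Vec (n + 1))} (M : Mesh n p Ω)

/-! ### Integration over faces -/

theorem measurableSet_facetDomain {β : Fin (n + 1) → ℕ} (j : Facet β) :
    MeasurableSet (facetDomain j) := (isClosed_refElem _).measurableSet

theorem continuous_facetPoint (K : M.Elem) (j : Facet (M.elemRef K)) :
    Continuous (M.facetPoint K j) := (M.continuous_elemMap K).comp (continuous_facetMap j)

theorem facetPoint_mem_closedElem (K : M.Elem) (j : Facet (M.elemRef K)) {y : Vec n}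
    (hy : y ∈ facetDomain j) : M.facetPoint K j y ∈ M.closedElem K :=
  mem_image_of_mem _ (facetMap_mem_refElem j hy)

theorem isCompact_faceSet (F : M.Face) : IsCompact (M.faceSet F) :=
  (isCompact_refElem _).image (continuous_polyMap _)

theorem isClosed_facePart (K : M.Elem) (j : Facet (M.elemRef K)) (F : M.Face) :
    IsClosed (M.facePart K j F) :=
  (M.isCompact_faceSet F).isClosed.preimage (M.continuous_facetPoint K j)

instance (K : M.Elem) (j : Facet (M.elemRef K)) : IsFiniteMeasure (M.facetMeasure K j) :=
  isFiniteMeasure_withDensity_ofReal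
    ((M.continuous_areaElement K j).continuousOn.integrableOn_compact
      (isCompact_refElem _) : IntegrableOn _ (facetDomain j) volume).2

theorem facetMeasure_absolutelyContinuous (K : M.Elem) (j : Facet (M.elemRef K)) :
    M.facetMeasure K j ≪ volume.restrict (facetDomain j) :=
  withDensity_absolutelyContinuous _ _

theorem facetMeasure_restrict_facetDomain (K : M.Elem) (j : Facet (M.elemRef K)) :
    (M.facetMeasure K j).restrict (facetDomain j) = M.facetMeasure K j :=
  Measure.restrict_eq_self_of_ae_mem ((M.facetMeasure_absolutelyContinuous K j).ae_le
    (ae_restrict_mem (measurableSet_facetDomain j)))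

theorem ae_mem_facePart (K : M.Elem) (j : Facet (M.elemRef K)) (F : M.Face) :
    ∀ᵐ y ∂(M.facetMeasure K j).restrict (M.facePart K j F),
      y ∈ facetDomain j ∧ M.facetPoint K j y ∈ M.faceSet F := by
  rw [← facetMeasure_restrict_facetDomain,
    Measure.restrict_restrict (M.isClosed_facePart K j F).measurableSet]
  filter_upwards [ae_restrict_mem ((M.isClosed_facePart K j F).measurableSet.inter
    (measurableSet_facetDomain j))] with y hy
  exact ⟨hy.2, hy.1⟩

theorem memLp_facetPoint {E : Type*} [NormedAddCommGroup E] {K : M.Elem}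
    (j : Facet (M.elemRef K)) {g : Vec (n + 1) → E} (hg : ContinuousOn g (M.closedElem K)) :
    MemLp (fun y => g (M.facetPoint K j y)) ⊤ (M.facetMeasure K j) := by
  rw [← facetMeasure_restrict_facetDomain]
  exact memLp_top_of_continuousOn (isCompact_refElem _) (measurableSet_facetDomain j) _
    (hg.comp (M.continuous_facetPoint K j).continuousOn fun y hy => M.facetPoint_mem_closedElem K j hy)

theorem memLp_facePart {E : Type*} [NormedAddCommGroup E] (K : M.Elem)
    (j : Facet (M.elemRef K)) {F : M.Face} {g : Vec (n + 1) → E}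
    (hg : ContinuousOn g (M.faceSet F)) :
    MemLp (fun y => g (M.facetPoint K j y)) ⊤
      ((M.facetMeasure K j).restrict (M.facePart K j F)) := by
  rw [← facetMeasure_restrict_facetDomain,
    Measure.restrict_restrict (M.isClosed_facePart K j F).measurableSet]
  exact memLp_top_of_continuousOn
    ((isCompact_refElem _).inter_left (M.isClosed_facePart K j F))
    ((M.isClosed_facePart K j F).measurableSet.inter (measurableSet_facetDomain j)) _
    (hg.comp (M.continuous_facetPoint K j).continuousOn fun y hy => hy.1)

/-- Measurability is clear once the sign of the determinant is replaced by its constant value, which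
is legitimate on the facet domain and hence almost everywhere. The bound `1` holds because a
component of the area vector is at most its Euclidean norm. -/
theorem memLp_normal (K : M.Elem) (j : Facet (M.elemRef K)) :
    MemLp (M.normal K j) ⊤ (M.facetMeasure K j) := by
  refine memLp_pi_iff.2 fun i => ?_
  have hm : Measurable fun y =>
      Real.sign (polyJac (M.elemPoly K) 0).det / M.areaElement K j y * M.areaVec K j y i :=
    (measurable_const.div (M.continuous_areaElement K j).measurable).mul
      (M.continuous_areaVec K j i).measurable
  have he : (fun y => Real.sign (polyJac (M.elemPoly K) 0).det / M.areaElement K j y *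
      M.areaVec K j y i) =ᵐ[M.facetMeasure K j] fun y => M.normal K j y i := by
    refine (M.facetMeasure_absolutelyContinuous K j).ae_le ?_
    filter_upwards [ae_restrict_mem (measurableSet_facetDomain j)] with y hy
    rw [← M.sign_det K (facetMap_mem_refElem j hy)]
    rfl
  refine MemLp.ae_eq he (memLp_top_of_bound hm.aestronglyMeasurable 1
    (Filter.Eventually.of_forall fun y => ?_))
  have h1 : |M.areaVec K j y i| ≤ M.areaElement K j y := by
    refine Real.abs_le_sqrt ?_
    rw [sq]
    exact Finset.single_le_sum (f := fun i => M.areaVec K j y i * M.areaVec K j y i)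
      (fun i _ => mul_self_nonneg _) (Finset.mem_univ i)
  have h2 : |Real.sign (polyJac (M.elemPoly K) 0).det| ≤ 1 := by
    rcases Real.sign_apply_eq (polyJac (M.elemPoly K) 0).det with h | h | h <;> simp [h]
  rw [Real.norm_eq_abs, abs_mul, abs_div, abs_of_nonneg (M.areaElement_nonneg K j y),
    div_mul_eq_mul_div]
  exact div_le_one_of_le₀ ((mul_le_mul h2 h1 (abs_nonneg _) zero_le_one).trans_eq (one_mul _))
    (M.areaElement_nonneg K j y)

/-- Integrability of a face integrand on all faces of the set `A`. -/
def FaceIntegrable (A : Set M.Face)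
    (g : (K : M.Elem) → Facet (M.elemRef K) → M.Face → Vec (n + 1) → Vec (n + 1) → ℝ) : Prop :=
  ∀ K j, ∀ F ∈ A, M.faceSet F ⊆ M.facetSet K j →
    Integrable (fun y => g K j F (M.facetPoint K j y) (M.normal K j y))
      ((M.facetMeasure K j).restrict (M.facePart K j F))

variable {M} {A B : Set M.Face}
  {g h : (K : M.Elem) → Facet (M.elemRef K) → M.Face → Vec (n + 1) → Vec (n + 1) → ℝ}

theorem FaceIntegrable.mono (hg : M.FaceIntegrable A g) (hAB : B ⊆ A) : M.FaceIntegrable B g :=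
  fun K j F hF => hg K j F (hAB hF)

theorem FaceIntegrable.sub (hg : M.FaceIntegrable A g) (hh : M.FaceIntegrable A h) :
    M.FaceIntegrable A fun K j F x ν => g K j F x ν - h K j F x ν :=
  fun K j F hF hs => (hg K j F hF hs).sub (hh K j F hF hs)

open Classical in
theorem faceSum_congr (H : ∀ K j, ∀ F ∈ A, ∀ y ∈ facetDomain j, M.facetPoint K j y ∈ M.faceSet F →
      g K j F (M.facetPoint K j y) (M.normal K j y) =
        h K j F (M.facetPoint K j y) (M.normal K j y)) :
    M.faceSum A g = M.faceSum A h := by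
  refine Finset.sum_congr rfl fun K _ => Finset.sum_congr rfl fun j _ =>
    Finset.sum_congr rfl fun F hF => integral_congr_ae ?_
  filter_upwards [M.ae_mem_facePart K j F] with y hy
  exact H K j F (Finset.mem_filter.1 hF).2.1 y hy.1 hy.2

open Classical in
theorem faceSum_add (hg : M.FaceIntegrable A g) (hh : M.FaceIntegrable A h) :
    M.faceSum A (fun K j F x ν => g K j F x ν + h K j F x ν) = M.faceSum A g + M.faceSum A h := by
  simp only [faceSum, ← Finset.sum_add_distrib]
  refine Finset.sum_congr rfl fun K _ => Finset.sum_congr rfl fun j _ =>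
    Finset.sum_congr rfl fun F hF => ?_
  have := (Finset.mem_filter.1 hF).2
  exact integral_add (hg K j F this.1 this.2) (hh K j F this.1 this.2)

open Classical in
theorem faceSum_sub (hg : M.FaceIntegrable A g) (hh : M.FaceIntegrable A h) :
    M.faceSum A (fun K j F x ν => g K j F x ν - h K j F x ν) = M.faceSum A g - M.faceSum A h := by
  simp only [faceSum, ← Finset.sum_sub_distrib]
  refine Finset.sum_congr rfl fun K _ => Finset.sum_congr rfl fun j _ =>
    Finset.sum_congr rfl fun F hF => ?_
  have := (Finset.mem_filter.1 hF).2
  exact integral_sub (hg K j F this.1 this.2) (hh K j F this.1 this.2)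

open Classical in
theorem faceSum_union (hAB : Disjoint A B) :
    M.faceSum (A ∪ B) g = M.faceSum A g + M.faceSum B g := by
  simp only [faceSum, ← Finset.sum_add_distrib]
  refine Finset.sum_congr rfl fun K _ => Finset.sum_congr rfl fun j _ => ?_
  rw [← Finset.sum_union]
  · refine Finset.sum_congr ?_ fun _ _ => rfl
    ext F
    simp only [Finset.mem_filter, Finset.mem_union, Finset.mem_univ, true_and, mem_union]
    tauto
  · rw [Finset.disjoint_filter]
    exact fun F _ h1 h2 => disjoint_left.1 hAB h1.1 h2.1

theorem faceSum_eq_zero (H : ∀ K j, ∀ F ∈ A, ∀ y ∈ facetDomain j,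
      M.facetPoint K j y ∈ M.faceSet F →
      g K j F (M.facetPoint K j y) (M.normal K j y) = 0) :
    M.faceSum A g = 0 := by
  rw [faceSum_congr (h := fun _ _ _ _ _ => 0) H]
  simp [faceSum]

open Classical in
theorem faceSum_nonneg (H : ∀ K j, ∀ F ∈ A, ∀ y ∈ facetDomain j,
      M.facetPoint K j y ∈ M.faceSet F →
      0 ≤ g K j F (M.facetPoint K j y) (M.normal K j y)) :
    0 ≤ M.faceSum A g := by
  refine Finset.sum_nonneg fun K _ => Finset.sum_nonneg fun j _ => Finset.sum_nonneg fun F hF =>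
    integral_nonneg_of_ae ?_
  filter_upwards [M.ae_mem_facePart K j F] with y hy
  exact H K j F (Finset.mem_filter.1 hF).2.1 y hy.1 hy.2

open Classical in
/-- A nonnegative face integrand with vanishing integral vanishes almost everywhere. -/
theorem ae_eq_zero_of_faceSum_eq_zero (hg : M.FaceIntegrable A g)
    (H : ∀ K j, ∀ F ∈ A, ∀ y ∈ facetDomain j, M.facetPoint K j y ∈ M.faceSet F →
      0 ≤ g K j F (M.facetPoint K j y) (M.normal K j y)) (h0 : M.faceSum A g = 0)
    (K : M.Elem) (j : Facet (M.elemRef K)) {F : M.Face} (hF : F ∈ A)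
    (hs : M.faceSet F ⊆ M.facetSet K j) :
    ∀ᵐ y ∂(M.facetMeasure K j).restrict (M.facePart K j F),
      g K j F (M.facetPoint K j y) (M.normal K j y) = 0 := by
  have hae : ∀ K j, ∀ F ∈ A, 0 ≤ᵐ[(M.facetMeasure K j).restrict (M.facePart K j F)]
      fun y => g K j F (M.facetPoint K j y) (M.normal K j y) := fun K j F hF => by
    filter_upwards [M.ae_mem_facePart K j F] with y hy
    exact H K j F hF y hy.1 hy.2
  have hnn : ∀ K j, ∀ F ∈ Finset.univ.filter (fun F => F ∈ A ∧ M.faceSet F ⊆ M.facetSet K j),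
      0 ≤ ∫ y in M.facePart K j F, g K j F (M.facetPoint K j y) (M.normal K j y)
        ∂(M.facetMeasure K j) := fun K j F hF =>
    integral_nonneg_of_ae (hae K j F (Finset.mem_filter.1 hF).2.1)
  unfold faceSum at h0
  have h1 := (Finset.sum_eq_zero_iff_of_nonneg fun K _ => Finset.sum_nonneg fun j _ =>
    Finset.sum_nonneg (hnn K j)).1 h0 K (Finset.mem_univ K)
  have h2 := (Finset.sum_eq_zero_iff_of_nonneg fun j _ =>
    Finset.sum_nonneg (hnn K j)).1 h1 j (Finset.mem_univ j)
  have h3 := (Finset.sum_eq_zero_iff_of_nonneg (hnn K j)).1 h2 F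
    (Finset.mem_filter.2 ⟨Finset.mem_univ F, hF, hs⟩)
  exact (integral_eq_zero_iff_of_nonneg_ae (hae K j F hF) (hg K j F hF hs)).1 h3

open Classical in
/-- The faces of a facet tile it, up to a null set. -/
theorem faceSum_univ_eq (g : (K : M.Elem) → Facet (M.elemRef K) → Vec (n + 1) → Vec (n + 1) → ℝ)
    (hg : ∀ K j, Integrable (fun y => g K j (M.facetPoint K j y) (M.normal K j y))
      (M.facetMeasure K j)) :
    M.faceSum univ (fun K j _ x ν => g K j x ν) =
      ∑ K, ∑ j : Facet (M.elemRef K),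
        ∫ y, g K j (M.facetPoint K j y) (M.normal K j y) ∂(M.facetMeasure K j) := by
  refine Finset.sum_congr rfl fun K _ => Finset.sum_congr rfl fun j _ => ?_
  set s : {F : M.Face // M.faceSet F ⊆ M.facetSet K j} → Set (Vec n) :=
    fun F => M.facePart K j F.1 with hs
  have hm : ∀ F, NullMeasurableSet (s F) (M.facetMeasure K j) := fun F =>
    (M.isClosed_facePart K j F.1).measurableSet.nullMeasurableSet
  -- Overlaps are null for the parameter volume, hence for the facet measure, which has a density.
  -- Below, `hu` says that the faces inside the facet cover it.
  have hd : Pairwise (Function.onFun (AEDisjoint (M.facetMeasure K j)) s) := by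
    intro F F' hne
    refine M.facetMeasure_absolutelyContinuous K j ?_
    rw [Measure.restrict_apply' (measurableSet_facetDomain j)]
    convert M.face_overlap K j F.1 F'.1 (fun h => hne (Subtype.ext h)) using 2
    ext y
    exact ⟨fun hy => ⟨hy.2, hy.1⟩, fun hy => ⟨hy.2, hy.1⟩⟩
  have hu : (M.facetMeasure K j).restrict (⋃ F, s F) = M.facetMeasure K j := by
    refine Measure.restrict_eq_self_of_ae_mem ?_
    refine (M.facetMeasure_absolutelyContinuous K j).ae_le ?_
    filter_upwards [ae_restrict_mem (measurableSet_facetDomain j)] with y hy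
    have h1 : M.facetPoint K j y ∈ M.facetSet K j := mem_image_of_mem _ hy
    have h2 := M.facet_eq_union K j
    have h3 : M.facetPoint K j y ∈ ⋃ F ∈ {F | M.faceSet F ⊆ M.facetSet K j}, M.faceSet F :=
      h2.subset h1
    simp only [mem_iUnion, exists_prop] at h3
    obtain ⟨F, hF, hy'⟩ := h3
    exact mem_iUnion.2 ⟨⟨F, hF⟩, hy'⟩
  conv_rhs => rw [← hu]
  rw [integral_iUnion_ae hm hd (hg K j).integrableOn, tsum_fintype]
  rw [← Finset.sum_subtype (p := fun F => M.faceSet F ⊆ M.facetSet K j)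
    (Finset.univ.filter fun F => F ∈ univ ∧ M.faceSet F ⊆ M.facetSet K j) (by simp)
    (fun F => ∫ y in M.facePart K j F, g K j (M.facetPoint K j y) (M.normal K j y)
      ∂(M.facetMeasure K j))]
  exact Finset.sum_congr (by ext; simp) fun _ _ => rfl

end Mesh

/-! ### Nodal bases -/

/-- Point evaluations at `D` span a subspace of the finite-dimensional dual of the polynomials of
degree at most `k`, and finitely many of them already span it. Values at these nodes therefore
determine a polynomial on `D`. The nodes need not be unisolvent and `b` need not be dual to them:
only reproduction on `D` is claimed. -/
theorem exists_interpolation {d : ℕ} (k : ℕ) (D : Set (Vec d)) :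
    ∃ (ι : Type) (_ : Fintype ι) (pt : ι → Vec d) (b : ι → MvPolynomial (Fin d) ℝ),
      (∀ i, pt i ∈ D) ∧ (∀ i, (b i).totalDegree ≤ k) ∧
      ∀ q : MvPolynomial (Fin d) ℝ, q.totalDegree ≤ k → ∀ ξ ∈ D,
        MvPolynomial.eval ξ q = ∑ i, MvPolynomial.eval (pt i) q * MvPolynomial.eval ξ (b i) := by
  classical
  let U := MvPolynomial.restrictTotalDegree (Fin d) ℝ k
  let ev : D → Module.Dual ℝ U := fun ξ =>
    (MvPolynomial.aeval (R := ℝ) (ξ : Vec d)).toLinearMap ∘ₗ U.subtype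
  obtain ⟨s', hs', hspan⟩ := (Submodule.fg_span_iff_fg_span_finset_subset (range ev)).1
    ((inferInstance : IsNoetherian ℝ (Module.Dual ℝ U)).noetherian _)
  choose pt hpt using fun i : s' => hs' i.2
  let R : U →ₗ[ℝ] (s' → ℝ) := LinearMap.pi fun i => ev (pt i)
  -- The nodal values of polynomials may fill only a proper subspace of `s' → ℝ`. A right inverse is
  -- chosen on that subspace and extended, so that it can be applied to the unit vectors.
  obtain ⟨g, hg⟩ := R.rangeRestrict.exists_rightInverse_of_surjective R.range_rangeRestrict
  obtain ⟨B, hB⟩ := LinearMap.exists_extend g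
  have hker : ∀ u : U, R u = 0 → ∀ ξ : D, ev ξ u = 0 := fun u hu ξ => by
    have h1 : ev ξ ∈ Submodule.span ℝ (s' : Set (Module.Dual ℝ U)) :=
      hspan ▸ Submodule.subset_span (mem_range_self ξ)
    refine Submodule.span_induction (p := fun f _ => f u = 0) (fun f hf => ?_) rfl
      (fun f f' _ _ h h' => by simp [h, h']) (fun c f _ h => by simp [h]) h1
    have := congrFun hu ⟨f, hf⟩
    simpa [R, hpt ⟨f, hf⟩] using this
  refine ⟨s', inferInstance, fun i => pt i, fun i => (B (Pi.single i 1) : U), fun i => (pt i).2,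
    fun i => (MvPolynomial.mem_restrictTotalDegree _ _ _).1 (B (Pi.single i 1)).2,
    fun q hq ξ hξ => ?_⟩
  let u : U := ⟨q, (MvPolynomial.mem_restrictTotalDegree _ _ _).2 hq⟩
  have h1 : R (B (R u)) = R u := by
    have h2 : B (R u) = g (R.rangeRestrict u) := (LinearMap.congr_fun hB (R.rangeRestrict u) :)
    have h3 := LinearMap.congr_fun hg (R.rangeRestrict u)
    rw [h2]
    exact congrArg Subtype.val h3
  -- `B (R u)` and `u` have the same nodal values, hence agree on `D`, though perhaps not as
  -- polynomials.
  have h4 := hker (B (R u) - u) (by rw [map_sub, h1, sub_self]) ⟨ξ, hξ⟩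
  rw [map_sub, sub_eq_zero] at h4
  have h5 : B (R u) = ∑ i, (R u i) • B (Pi.single i 1) := by
    conv_lhs => rw [pi_eq_sum_univ' (R u), map_sum]
    simp only [map_smul]
  rw [h5, map_sum] at h4
  simp only [map_smul, smul_eq_mul] at h4
  exact h4.symm

namespace Mesh

variable {n p : ℕ} {Ω : Set (Vec (n + 1))} (M : Mesh n p Ω)

/-- The scalar discontinuous space on one element. -/
def LocalPoly (k : ℕ) (K : M.Elem) (g : Vec (n + 1) → ℝ) : Prop :=
  IsPolyOn k (fun ξ => g (M.elemMap K ξ)) (refElem (M.elemRef K))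

variable {M}

theorem LocalPoly.exists_pullsBack {k : ℕ} {K : M.Elem} {g : Vec (n + 1) → ℝ}
    (hg : M.LocalPoly k K g) : ∃ q, M.PullsBack K g q :=
  let ⟨q, _, hq⟩ := hg
  ⟨q, hq⟩

theorem LocalPoly.continuousOn {k : ℕ} {K : M.Elem} {g : Vec (n + 1) → ℝ}
    (hg : M.LocalPoly k K g) : ContinuousOn g (M.closedElem K) :=
  let ⟨_, hq⟩ := hg.exists_pullsBack
  hq.continuousOn

theorem LocalPoly.sum_const_mul {k : ℕ} {K : M.Elem} {ι : Type*} [Fintype ι]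
    {g : ι → Vec (n + 1) → ℝ} (hg : ∀ i, M.LocalPoly k K (g i)) (c : ι → ℝ)
    {h : Vec (n + 1) → ℝ} (hh : ∀ x ∈ M.closedElem K, h x = ∑ i, c i * g i x) :
    M.LocalPoly k K h := by
  choose q hq hgq using hg
  refine ⟨∑ i, MvPolynomial.C (c i) * q i, ?_, fun ξ hξ => ?_⟩
  · refine MvPolynomial.totalDegree_finsetSum_le fun i _ => ?_
    refine (MvPolynomial.totalDegree_mul _ _).trans ?_
    simpa using hq i
  · simp only [hh _ (mem_image_of_mem _ hξ), map_sum, map_mul, MvPolynomial.eval_C, ← hgq _ ξ hξ]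

variable (M)

/-- Interpolation on the reference element is transported by the inverse of the element mapping. The
coefficients are point values of the field, so a time-dependent field separates into functions of
time and fixed functions of space. -/
theorem exists_nodalBasis (k : ℕ) (K : M.Elem) :
    ∃ (ι : Type) (_ : Fintype ι) (pt : ι → Vec (n + 1)) (B : ι → Vec (n + 1) → ℝ),
      (∀ i, pt i ∈ M.closedElem K) ∧ (∀ i, M.LocalPoly k K (B i)) ∧
      ∀ g, M.LocalPoly k K g → ∀ x ∈ M.closedElem K, g x = ∑ i, g (pt i) * B i x := by
  obtain ⟨ι, hι, pt, b, hpt, hb, H⟩ := exists_interpolation k (refElem (M.elemRef K))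
  have hinv : ∀ ξ ∈ refElem (M.elemRef K),
      Function.invFunOn (M.elemMap K) (refElem (M.elemRef K)) (M.elemMap K ξ) = ξ := fun ξ hξ =>
    (M.elemPoly_injOn K).leftInvOn_invFunOn hξ
  refine ⟨ι, hι, fun i => M.elemMap K (pt i), fun i x => MvPolynomial.eval
    (Function.invFunOn (M.elemMap K) (refElem (M.elemRef K)) x) (b i),
    fun i => mem_image_of_mem _ (hpt i), fun i => ⟨b i, hb i, fun ξ hξ => ?_⟩, ?_⟩
  · simp only [hinv ξ hξ]
  · rintro g ⟨q, hq, hgq⟩ _ ⟨ξ, hξ, rfl⟩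
    simp only at hgq
    simp only [hinv ξ hξ, hgq ξ hξ, hgq _ (hpt _)]
    exact H q hq ξ hξ

end Mesh

/-! ### Differentiation of energies in time -/

/-- A combination of continuous functions with constant vector coefficients is continuous. -/
theorem continuousOn_sum_smul {X E ι : Type*} [TopologicalSpace X] [NormedAddCommGroup E]
    [NormedSpace ℝ E] [Fintype ι] {S : Set X} {B : ι → X → ℝ}
    (hB : ∀ i, ContinuousOn (B i) S) (c : ι → E) :
    ContinuousOn (fun x => ∑ i, B i x • c i) S :=
  continuousOn_finsetSum _ fun i _ => (hB i).smul continuousOn_const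

section Energy

variable {X E : Type*} [TopologicalSpace X] [MeasurableSpace X] [OpensMeasurableSpace X]
  [NormedAddCommGroup E] [NormedSpace ℝ E] [FiniteDimensional ℝ E]

/-- A `C¹` function is uniformly Lipschitz near a compact subset of its domain. -/
theorem exists_lipschitz_near_compact {Φ : E → ℝ} {O N : Set E} (hO : IsOpen O)
    (hΦ : ContDiffOn ℝ 1 Φ O) (hN : IsCompact N) (hNO : N ⊆ O) :
    ∃ δ > 0, ∃ L, 0 ≤ L ∧ ∀ a ∈ N, ∀ b, ‖b - a‖ ≤ δ → |Φ b - Φ a| ≤ L * ‖b - a‖ := by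
  obtain ⟨δ, hδ, hδO⟩ := hN.exists_cthickening_subset_open hO hNO
  have hcomp : IsCompact (Metric.cthickening δ N) := hN.cthickening
  obtain ⟨L, hL⟩ := hcomp.exists_bound_of_continuousOn
    ((hΦ.continuousOn_fderiv_of_isOpen hO le_rfl).mono hδO)
  refine ⟨δ, hδ, max L 0, le_max_right _ _, fun a ha b hb => ?_⟩
  have hball : Metric.closedBall a δ ⊆ Metric.cthickening δ N :=
    Metric.closedBall_subset_cthickening ha δ
  refine (convex_closedBall a δ).norm_image_sub_le_of_norm_fderiv_le (𝕜 := ℝ) (f := Φ)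
    (fun x hx => (hΦ.differentiableOn one_ne_zero).differentiableAt
      (hO.mem_nhds (hδO (hball hx))))
    (fun x hx => (hL x (hball hx)).trans (le_max_left _ _))
    (Metric.mem_closedBall_self hδ.le) ?_
  rwa [mem_closedBall_iff_norm]

variable {ι : Type*} [Fintype ι] {S : Set X} {μ : Measure X} {B : ι → X → ℝ} {T : ℝ}
  {c : ι → ℝ → E} {r : X → ℝ} {Φ : E → ℝ} {O : Set E}

/-- In the applications `μ` is the volume on the open element and `S` the closed element. The
hypothesis `hμ` says that `μ` is carried by the compact set on which the basis is continuous. -/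
theorem memLp_energyDensity [SecondCountableTopologyEither X ℝ] (hS : IsCompact S)
    (hSm : MeasurableSet S) (hμ : μ.restrict S = μ)
    (hB : ∀ i, ContinuousOn (B i) S) {g : E → ℝ} (hg : ContinuousOn g O) (a : ι → E)
    (ha : ∀ x ∈ S, ∑ i, B i x • a i ∈ O) :
    MemLp (fun x => g (∑ i, B i x • a i)) ⊤ μ := by
  rw [← hμ]
  exact memLp_top_of_continuousOn hS hSm _ (hg.comp (continuousOn_sum_smul hB a) ha)

/-- Differentiation in time of the energy of a field with values in a finite-dimensional space. -/
theorem hasDerivAt_energy [SecondCountableTopologyEither X ℝ] [IsFiniteMeasure μ]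
    (hS : IsCompact S) (hSm : MeasurableSet S) (hμ : μ.restrict S = μ)
    (hB : ∀ i, ContinuousOn (B i) S) (hr : MemLp r ⊤ μ) (hO : IsOpen O) (hΦ : ContDiffOn ℝ 1 Φ O)
    {t : ℝ} {c' : ι → E} (hc : ∀ i, HasDerivAt (c i) (c' i) t)
    (hdom : ∀ᶠ s in nhds t, ∀ x ∈ S, ∑ i, B i x • c i s ∈ O) :
    HasDerivAt (fun s => ∫ x, r x * Φ (∑ i, B i x • c i s) ∂μ)
      (∫ x, r x * fderiv ℝ Φ (∑ i, B i x • c i t) (∑ i, B i x • c' i) ∂μ) t := by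
  have hdt : ∀ x ∈ S, ∑ i, B i x • c i t ∈ O := hdom.self_of_nhds
  obtain ⟨δ, hδ, L, hL0, hL⟩ := exists_lipschitz_near_compact hO hΦ
    (hS.image_of_continuousOn (continuousOn_sum_smul hB fun i => c i t))
    (image_subset_iff.2 hdt)
  have hbB : ∀ i, ∃ C, ∀ x ∈ S, ‖B i x‖ ≤ C := fun i => hS.exists_bound_of_continuousOn (hB i)
  choose C hC using hbB
  -- The coefficients are only assumed differentiable at `t`, so only increments measured from `t`
  -- are controlled. This is enough for the version of differentiation under the integral used
  -- below.
  have hcl : ∀ i, ∃ A > 0, ∀ᶠ s in nhds t, ‖c i s - c i t‖ ≤ A * ‖s - t‖ := fun i => by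
    obtain ⟨A, hA⟩ := (hc i).isBigO_sub.bound
    exact ⟨max A 1, by positivity, hA.mono fun s hs =>
      hs.trans (mul_le_mul_of_nonneg_right (le_max_left _ _) (norm_nonneg _))⟩
  choose A hA0 hA using hcl
  set A' := ∑ i, |C i| * A i with hA'
  have hA'0 : 0 ≤ A' := Finset.sum_nonneg fun i _ => mul_nonneg (abs_nonneg _) (hA0 i).le
  have hu : ∀ᶠ s in nhds t, ∀ x ∈ S,
      ‖∑ i, B i x • c i s - ∑ i, B i x • c i t‖ ≤ A' * ‖s - t‖ := by
    filter_upwards [Filter.eventually_all.2 hA] with s hs x hx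
    rw [← Finset.sum_sub_distrib, hA', Finset.sum_mul]
    refine norm_sum_le_of_le _ fun i _ => ?_
    rw [← smul_sub, norm_smul, mul_assoc]
    exact mul_le_mul ((hC i x hx).trans (le_abs_self _)) (hs i) (norm_nonneg _) (abs_nonneg _)
  have hsmall : ∀ᶠ s in nhds t, A' * ‖s - t‖ ≤ δ := by
    have h1 : Filter.Tendsto (fun s => A' * ‖s - t‖) (nhds t) (nhds (A' * ‖t - t‖)) :=
      (by fun_prop : Continuous fun s => A' * ‖s - t‖).tendsto t
    rw [sub_self, norm_zero, mul_zero] at h1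
    exact (h1.eventually_lt_const hδ).mono fun _ h => h.le
  have hae : ∀ᵐ x ∂μ, x ∈ S := by rw [← hμ]; exact ae_restrict_mem hSm
  have hmeas : ∀ s, (∀ x ∈ S, ∑ i, B i x • c i s ∈ O) →
      MemLp (fun x => r x * Φ (∑ i, B i x • c i s)) ⊤ μ := fun s hs =>
    (memLp_energyDensity hS hSm hμ hB hΦ.continuousOn (fun i => c i s) hs).mul' hr
  have hfd : ContinuousOn (fun x => fderiv ℝ Φ (∑ i, B i x • c i t) (∑ i, B i x • c' i)) S :=
    ((hΦ.continuousOn_fderiv_of_isOpen hO le_rfl).comp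
      (continuousOn_sum_smul hB fun i => c i t) hdt).clm_apply (continuousOn_sum_smul hB c')
  have hF' : MemLp (fun x => r x * fderiv ℝ Φ (∑ i, B i x • c i t) (∑ i, B i x • c' i)) ⊤ μ := by
    refine MemLp.mul' ?_ hr (p := ⊤) (q := ⊤)
    rw [← hμ]
    exact memLp_top_of_continuousOn hS hSm _ hfd
  -- The neighbourhood keeps the field in `O` and within `δ` of its value at `t`. There `Φ` is
  -- `L`-Lipschitz from its value at `t` and the field moves at rate at most `A'`, hence the
  -- dominating function `|r| * (L * A')`.
  have key := hasFDerivAt_integral_of_dominated_loc_of_lip' (μ := μ) (𝕜 := ℝ)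
    (F := fun s x => r x * Φ (∑ i, B i x • c i s)) (x₀ := t)
    (bound := fun x => |r x| * (L * A'))
    (F' := fun x => (1 : ℝ →L[ℝ] ℝ).smulRight
      (r x * fderiv ℝ Φ (∑ i, B i x • c i t) (∑ i, B i x • c' i)))
    (Filter.inter_mem (Filter.inter_mem hu hsmall) hdom)
    (fun s hs => (hmeas s hs.2).1)
    ((hmeas t hdt).integrable le_top)
    (((ContinuousLinearMap.smulRightL ℝ ℝ ℝ 1).continuous.comp_aestronglyMeasurable hF'.1))
    ?_ ((hr.integrable le_top).abs.mul_const _) ?_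
  · have h2 := key.2.hasDerivAt
    refine h2.congr_deriv ?_
    rw [ContinuousLinearMap.integral_apply key.1]
    simp
  · filter_upwards [hae] with x hx s hs
    rw [← mul_sub, norm_mul, Real.norm_eq_abs, Real.norm_eq_abs, mul_assoc, mul_assoc]
    refine mul_le_mul_of_nonneg_left ?_ (abs_nonneg _)
    refine (hL _ (mem_image_of_mem _ hx) _ ((hs.1.1 x hx).trans hs.1.2)).trans ?_
    exact mul_le_mul_of_nonneg_left (hs.1.1 x hx) hL0
  · filter_upwards [hae] with x hx
    have h1 : HasDerivAt (fun s => ∑ i, B i x • c i s) (∑ i, B i x • c' i) t :=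
      HasDerivAt.fun_sum fun i _ => (hc i).const_smul (B i x)
    have h2 := ((hΦ.differentiableOn one_ne_zero).differentiableAt
      (hO.mem_nhds (hdt x hx))).hasFDerivAt.comp_hasDerivAt t h1
    exact (h2.const_mul (r x)).hasFDerivAt

/-- The density is jointly continuous on the compact set `[0, T] × S`, hence uniformly bounded, and
dominated convergence applies. The end points matter: differentiability is known only inside the
interval, while decay is claimed on the closed one. -/
theorem continuousOn_energy [SecondCountableTopologyEither X ℝ] [IsFiniteMeasure μ]
    (hS : IsCompact S) (hSm : MeasurableSet S) (hμ : μ.restrict S = μ)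
    (hB : ∀ i, ContinuousOn (B i) S) (hr : MemLp r ⊤ μ) (hΦ : ContinuousOn Φ O)
    (hc : ∀ i, ContinuousOn (c i) (Icc 0 T))
    (hdom : ∀ s ∈ Icc 0 T, ∀ x ∈ S, ∑ i, B i x • c i s ∈ O) :
    ContinuousOn (fun s => ∫ x, r x * Φ (∑ i, B i x • c i s) ∂μ) (Icc 0 T) := by
  have hjoint : ContinuousOn (fun z : ℝ × X => Φ (∑ i, B i z.2 • c i z.1)) (Icc 0 T ×ˢ S) := by
    refine hΦ.comp (continuousOn_finsetSum _ fun i _ => ?_) fun z hz => hdom z.1 hz.1 z.2 hz.2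
    exact ((hB i).comp continuousOn_snd fun z hz => hz.2).smul
      ((hc i).comp continuousOn_fst fun z hz => hz.1)
  obtain ⟨C, hC⟩ := (isCompact_Icc.prod hS).exists_bound_of_continuousOn hjoint
  have hae : ∀ᵐ x ∂μ, x ∈ S := by rw [← hμ]; exact ae_restrict_mem hSm
  intro t ht
  refine continuousWithinAt_of_dominated (bound := fun x => |r x| * C) ?_ ?_
    ((hr.integrable le_top).abs.mul_const _) ?_
  · filter_upwards [self_mem_nhdsWithin] with s hs
    exact hr.1.mul (memLp_energyDensity hS hSm hμ hB hΦ (fun i => c i s) (hdom s hs)).1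
  · filter_upwards [self_mem_nhdsWithin] with s hs
    filter_upwards [hae] with x hx
    rw [norm_mul, Real.norm_eq_abs]
    exact mul_le_mul_of_nonneg_left (hC (s, x) ⟨hs, hx⟩) (abs_nonneg _)
  · filter_upwards [hae] with x hx
    exact (hjoint.comp (f := fun s => (s, x)) (by fun_prop)
      (fun s hs => ⟨hs, hx⟩) t ht).const_mul (r x)

end Energy

theorem frob_eq_sum {d : ℕ} (A B : Mat d) : frob A B = ∑ i, ∑ j, A i j * B i j := by
  simp only [frob, Matrix.trace, Matrix.diag, Matrix.mul_apply, Matrix.transpose_apply]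
  exact Finset.sum_comm

theorem frob_comm {d : ℕ} (A B : Mat d) : frob A B = frob B A := by
  simp only [frob_eq_sum, mul_comm]

namespace Mesh

variable {n p k : ℕ} {Ω : Set (Vec (n + 1))} {M : Mesh n p Ω}

/-! ### The discontinuous spaces -/

theorem continuousOn_of_mem_Q {G : M.Elem → Vec (n + 1) → Mat (n + 1)} (hG : G ∈ M.Q k)
    (K : M.Elem) : ContinuousOn (G K) (M.closedElem K) :=
  continuousOn_pi.2 fun i => continuousOn_pi.2 fun j =>
    (LocalPoly.continuousOn (k := k) (g := fun x => G K x i j) (hG K i j))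

theorem continuousOn_of_mem_V {w : M.Elem → Vec (n + 1) → Vec (n + 1)} (hw : w ∈ M.V k)
    (K : M.Elem) : ContinuousOn (w K) (M.closedElem K) :=
  continuousOn_pi.2 fun i => LocalPoly.continuousOn (k := k) (g := fun x => w K x i) (hw K i)

theorem continuousOn_of_mem_Trace {EE : Set M.Face} {μ : M.Face → Vec (n + 1) → Vec (n + 1)}
    (hμ : μ ∈ M.Trace k EE) (F : M.Face) : ContinuousOn (μ F) (M.faceSet F) := by
  refine continuousOn_image_of_comp (isCompact_refElem _) (continuous_polyMap _).continuousOn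
    (continuousOn_pi.2 fun i => ?_)
  obtain ⟨q, -, hq⟩ := hμ.1 F i
  exact (MvPolynomial.continuous_eval q).continuousOn.congr hq

theorem restrict_closedElem (K : M.Elem) :
    (volume.restrict (M.elemSet K)).restrict (M.closedElem K) = volume.restrict (M.elemSet K) := by
  rw [Measure.restrict_restrict (M.isCompact_closedElem K).measurableSet,
    inter_eq_right.2 (M.elemSet_subset_closedElem K)]

theorem elemSet_subset (K : M.Elem) : M.elemSet K ⊆ Ω := M.elem_subset K

instance (K : M.Elem) : IsFiniteMeasure (volume.restrict (M.elemSet K)) :=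
  ⟨by
    rw [Measure.restrict_apply_univ]
    exact (measure_mono (M.elemSet_subset_closedElem K)).trans_lt
      (M.isCompact_closedElem K).measure_lt_top⟩

theorem memLp_elemSet {E : Type*} [NormedAddCommGroup E] {K : M.Elem} {g : Vec (n + 1) → E}
    (hg : ContinuousOn g (M.closedElem K)) : MemLp g ⊤ (volume.restrict (M.elemSet K)) := by
  rw [← restrict_closedElem]
  exact memLp_top_of_continuousOn (M.isCompact_closedElem K)
    (M.isCompact_closedElem K).measurableSet _ hg

theorem elemSum_congr {g h : M.Elem → Vec (n + 1) → ℝ}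
    (H : ∀ K, ∀ x ∈ M.elemSet K, g K x = h K x) : M.elemSum g = M.elemSum h :=
  Finset.sum_congr rfl fun K _ => setIntegral_congr_fun (M.measurableSet_elemSet K) (H K)

theorem elemSum_add {g h : M.Elem → Vec (n + 1) → ℝ}
    (hg : ∀ K, IntegrableOn (g K) (M.elemSet K)) (hh : ∀ K, IntegrableOn (h K) (M.elemSet K)) :
    M.elemSum (fun K x => g K x + h K x) = M.elemSum g + M.elemSum h := by
  simp only [elemSum, ← Finset.sum_add_distrib]
  exact Finset.sum_congr rfl fun K _ => integral_add (hg K) (hh K)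

theorem integrableOn_frob {K : M.Elem} {A B : Vec (n + 1) → Mat (n + 1)}
    (hA : ContinuousOn A (M.closedElem K)) (hB : ContinuousOn B (M.closedElem K)) :
    IntegrableOn (fun x => frob (A x) (B x)) (M.elemSet K) := by
  refine (memLp_elemSet ?_).integrable le_top
  simp only [frob_eq_sum]
  have h : ∀ {A : Vec (n + 1) → Mat (n + 1)}, ContinuousOn A (M.closedElem K) →
      ∀ i j, ContinuousOn (fun x => A x i j) (M.closedElem K) := fun hA i j =>
    continuousOn_pi.1 (continuousOn_pi.1 hA i) j
  exact continuousOn_finsetSum _ fun i _ => continuousOn_finsetSum _ fun j _ =>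
    (h hA i j).mul (h hB i j)

/-- Green's formula for the discontinuous spaces. -/
theorem elemSum_div_add_elemSum_grad {G : M.Elem → Vec (n + 1) → Mat (n + 1)}
    {w : M.Elem → Vec (n + 1) → Vec (n + 1)} (hG : G ∈ M.Q k) (hw : w ∈ M.V k) :
    M.elemSum (fun K x => w K x ⬝ᵥ div (G K) x) +
        M.elemSum (fun K x => frob (G K x) (grad (w K) x)) =
      M.faceSum univ (fun K _ _ x ν => (G K x).mulVec ν ⬝ᵥ w K x) := by
  have hGp : ∀ K i j, ∃ q, M.PullsBack K (fun x => G K x i j) q := fun K i j =>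
    LocalPoly.exists_pullsBack (k := k) (g := fun x => G K x i j) (hG K i j)
  have hwp : ∀ K i, ∃ q, M.PullsBack K (fun x => w K x i) q := fun K i =>
    LocalPoly.exists_pullsBack (k := k) (g := fun x => w K x i) (hw K i)
  choose qG hqG using hGp
  choose qw hqw using hwp
  have hf : ∀ K (j : Facet (M.elemRef K)) i l, Integrable (fun y =>
      G K (M.facetPoint K j y) i l * w K (M.facetPoint K j y) i * M.normal K j y l)
      (M.facetMeasure K j) := fun K j i l => by
    have h1 := M.memLp_facetPoint j (hqG K i l).continuousOn
    have h2 := M.memLp_facetPoint j (hqw K i).continuousOn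
    exact (((M.memLp_normal K j).eval l).mul' (p := ⊤) (q := ⊤) (r := ⊤)
      (h2.mul' (p := ⊤) (q := ⊤) (r := ⊤) h1)).integrable le_top
  have he : ∀ K (j : Facet (M.elemRef K)) y, (G K (M.facetPoint K j y)).mulVec (M.normal K j y) ⬝ᵥ
      w K (M.facetPoint K j y) = ∑ i, ∑ l,
        G K (M.facetPoint K j y) i l * w K (M.facetPoint K j y) i * M.normal K j y l := by
    intro K j y
    simp only [dotProduct, Matrix.mulVec, Finset.sum_mul]
    exact Finset.sum_congr rfl fun i _ => Finset.sum_congr rfl fun l _ => by ring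
  -- The integrand does not depend on the face, so the face sum collapses to whole facets and
  -- integration by parts can be used for each pair of indices.
  rw [M.faceSum_univ_eq (fun K _ x ν => (G K x).mulVec ν ⬝ᵥ w K x) fun K j => by
    simp only [he]
    exact integrable_finsetSum _ fun i _ => integrable_finsetSum _ fun l _ => hf K j i l]
  simp only [elemSum, ← Finset.sum_add_distrib]
  refine Finset.sum_congr rfl fun K _ => ?_
  have h1 : ∫ x in M.elemSet K, w K x ⬝ᵥ div (G K) x = ∑ i, ∑ l, ∫ x in M.elemSet K,
      w K x i * fderiv ℝ (fun z => G K z i l) x (Pi.single l 1) := by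
    simp only [dotProduct, div, Finset.mul_sum]
    rw [integral_finsetSum _ fun i _ => integrable_finsetSum _ fun l _ =>
      (hqG K i l).integrableOn_mul_fderiv (hqw K i) l]
    exact Finset.sum_congr rfl fun i _ => integral_finsetSum _ fun l _ =>
      (hqG K i l).integrableOn_mul_fderiv (hqw K i) l
  have h2 : ∫ x in M.elemSet K, frob (G K x) (grad (w K) x) = ∑ i, ∑ l, ∫ x in M.elemSet K,
      G K x i l * fderiv ℝ (fun z => w K z i) x (Pi.single l 1) := by
    simp only [frob_eq_sum, grad, Matrix.of_apply]
    rw [integral_finsetSum _ fun i _ => integrable_finsetSum _ fun l _ =>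
      (hqw K i).integrableOn_mul_fderiv (hqG K i l) l]
    exact Finset.sum_congr rfl fun i _ => integral_finsetSum _ fun l _ =>
      (hqw K i).integrableOn_mul_fderiv (hqG K i l) l
  have h3 : ∀ j : Facet (M.elemRef K), ∫ y, (G K (M.facetPoint K j y)).mulVec (M.normal K j y) ⬝ᵥ
      w K (M.facetPoint K j y) ∂(M.facetMeasure K j) = ∑ i, ∑ l, ∫ y,
        G K (M.facetPoint K j y) i l * w K (M.facetPoint K j y) i * M.normal K j y l
          ∂(M.facetMeasure K j) := fun j => by
    simp only [he]
    rw [integral_finsetSum _ fun i _ => integrable_finsetSum _ fun l _ => hf K j i l]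
    exact Finset.sum_congr rfl fun i _ => integral_finsetSum _ fun l _ => hf K j i l
  rw [h1, h2, Finset.sum_congr rfl fun j _ => h3 j, ← Finset.sum_add_distrib, Finset.sum_comm]
  refine Finset.sum_congr rfl fun i _ => ?_
  rw [← Finset.sum_add_distrib, Finset.sum_comm]
  exact Finset.sum_congr rfl fun l _ => (hqG K i l).integral_by_parts (hqw K i) l

/-! ### Time derivatives of discrete fields -/

variable (M) in
/-- Nodal representation of the matrix and vector fields of the discontinuous spaces on `K`. -/
theorem exists_nodalBasis_fields (k : ℕ) (K : M.Elem) :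
    ∃ (ι : Type) (_ : Fintype ι) (pt : ι → Vec (n + 1)) (B : ι → Vec (n + 1) → ℝ),
      (∀ i, pt i ∈ M.closedElem K) ∧ (∀ i, M.LocalPoly k K (B i)) ∧
      (∀ G ∈ M.Q k, ∀ x ∈ M.closedElem K, G K x = ∑ i, B i x • G K (pt i)) ∧
      ∀ w ∈ M.V k, ∀ x ∈ M.closedElem K, w K x = ∑ i, B i x • w K (pt i) := by
  obtain ⟨ι, hι, pt, B, hpt, hB, H⟩ := M.exists_nodalBasis k K
  refine ⟨ι, hι, pt, B, hpt, hB, fun G hG x hx => ?_, fun w hw x hx => ?_⟩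
  · ext i j
    rw [Matrix.sum_apply, H (fun x => G K x i j) (hG K i j) x hx]
    exact Finset.sum_congr rfl fun a _ => mul_comm _ _
  · ext i
    rw [Finset.sum_apply, H (fun x => w K x i) (hw K i) x hx]
    exact Finset.sum_congr rfl fun a _ => mul_comm _ _

/-- A curve in the span of finitely many curves is differentiated coefficientwise. -/
theorem deriv_eq_sum_smul {E : Type*} [NormedAddCommGroup E] [NormedSpace ℝ E] {ι : Type*}
    [Fintype ι] {T t : ℝ} (ht : t ∈ Ioo 0 T) {f : ℝ → E} {c : ι → ℝ → E} {b : ι → ℝ}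
    (hf : ∀ s ∈ Icc 0 T, f s = ∑ i, b i • c i s) (hc : ∀ i, DifferentiableAt ℝ (c i) t) :
    deriv f t = ∑ i, b i • deriv (c i) t := by
  have h1 : f =ᶠ[nhds t] fun s => ∑ i, b i • c i s :=
    Filter.eventually_of_mem (Icc_mem_nhds ht.1 ht.2) hf
  rw [h1.deriv_eq]
  exact (HasDerivAt.fun_sum fun i _ => ((hc i).hasDerivAt.const_smul (b i))).deriv

/-- The time derivative has the same nodal representation, with differentiated coefficients. This
makes `∂ₜF_h` an admissible test function in the constitutive equation. -/
theorem deriv_mem_Q {T t : ℝ} (ht : t ∈ Ioo 0 T) {F : ℝ → M.Elem → Vec (n + 1) → Mat (n + 1)}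
    (hF : ∀ s ∈ Icc 0 T, F s ∈ M.Q k)
    (hd : ∀ K, ∀ x ∈ M.closedElem K, DifferentiableAt ℝ (fun s => F s K x) t) :
    (fun K x => deriv (fun s => F s K x) t) ∈ M.Q k := by
  intro K i j
  obtain ⟨ι, hι, pt, B, hpt, hB, H, -⟩ := M.exists_nodalBasis_fields k K
  refine LocalPoly.sum_const_mul hB (fun a => deriv (fun s => F s K (pt a)) t i j)
    (h := fun x => deriv (fun s => F s K x) t i j) fun x hx => ?_
  refine (congrArg (fun A : Mat (n + 1) => A i j) (deriv_eq_sum_smul ht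
    (fun s hs => H _ (hF s hs) x hx) fun a => hd K _ (hpt a))).trans ?_
  refine (Matrix.sum_apply ..).trans ?_
  exact Finset.sum_congr rfl fun a _ => mul_comm _ _

theorem deriv_mem_V {T t : ℝ} (ht : t ∈ Ioo 0 T) {v : ℝ → M.Elem → Vec (n + 1) → Vec (n + 1)}
    (hv : ∀ s ∈ Icc 0 T, v s ∈ M.V k)
    (hd : ∀ K, ∀ x ∈ M.closedElem K, DifferentiableAt ℝ (fun s => v s K x) t) :
    (fun K x => deriv (fun s => v s K x) t) ∈ M.V k := by
  intro K i
  obtain ⟨ι, hι, pt, B, hpt, hB, -, H⟩ := M.exists_nodalBasis_fields k K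
  refine LocalPoly.sum_const_mul hB (fun a => deriv (fun s => v s K (pt a)) t i)
    (h := fun x => deriv (fun s => v s K x) t i) fun x hx => ?_
  rw [deriv_eq_sum_smul ht (fun s hs => H _ (hv s hs) x hx) fun a => hd K _ (hpt a),
    Finset.sum_apply]
  exact Finset.sum_congr rfl fun a _ => mul_comm _ _

end Mesh

namespace Data

variable {n p k : ℕ} {Ω : Set (Vec (n + 1))} {M : Mesh n p Ω} {D : Data M} {T t : ℝ}
  {EE : Set M.Face} {F P : ℝ → M.Elem → Vec (n + 1) → Mat (n + 1)}
  {v : ℝ → M.Elem → Vec (n + 1) → Vec (n + 1)} {vhat : ℝ → M.Face → Vec (n + 1) → Vec (n + 1)}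

/-! ### The energy identity -/

theorem Admissible.memLp_rho (hD : D.Admissible T) (K : M.Elem) :
    MemLp D.rho ⊤ (volume.restrict (M.elemSet K)) :=
  hD.rho_bounded.mono_measure (Measure.restrict_mono (M.elemSet_subset K) le_rfl)

section Faces

variable {Pt : M.Elem → Vec (n + 1) → Mat (n + 1)} {vt : M.Elem → Vec (n + 1) → Vec (n + 1)}
  {vh : M.Face → Vec (n + 1) → Vec (n + 1)}

theorem memLp_jump (hv : vt ∈ M.V k) (hvh : vh ∈ M.Trace k EE) (K : M.Elem)
    (j : Facet (M.elemRef K)) (E : M.Face) :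
    MemLp (fun y => jump vt vh K E (M.facetPoint K j y)) ⊤
      ((M.facetMeasure K j).restrict (M.facePart K j E)) :=
  ((M.memLp_facetPoint j (Mesh.continuousOn_of_mem_V hv K)).restrict _).sub
    (M.memLp_facePart K j (Mesh.continuousOn_of_mem_Trace hvh E))

theorem memLp_stress_normal (hP : Pt ∈ M.Q k) (K : M.Elem) (j : Facet (M.elemRef K)) :
    MemLp (fun y => (Pt K (M.facetPoint K j y)).mulVec (M.normal K j y)) ⊤
      (M.facetMeasure K j) :=
  memLp_mulVec (M.memLp_facetPoint j (Mesh.continuousOn_of_mem_Q hP K)) (M.memLp_normal K j)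

theorem Admissible.memLp_stabilization (hD : D.Admissible T) (ht : t ∈ Ioo 0 T) (hv : vt ∈ M.V k)
    (hvh : vh ∈ M.Trace k EE) (K : M.Elem) (j : Facet (M.elemRef K)) (E : M.Face) :
    MemLp (fun y => (D.S t K j (M.facetPoint K j y)).mulVec
        (jump vt vh K E (M.facetPoint K j y))) ⊤
      ((M.facetMeasure K j).restrict (M.facePart K j E)) :=
  memLp_mulVec ((memLp_pi_iff (E := fun _ => Vec (n + 1))).2 fun i =>
    ((memLp_pi_iff (E := fun _ => Vec (n + 1))).1 (hD.S_bounded t ht K j) i).restrict _)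
    (memLp_jump hv hvh K j E)

theorem Admissible.memLp_flux (hD : D.Admissible T) (ht : t ∈ Ioo 0 T) (hP : Pt ∈ M.Q k)
    (hv : vt ∈ M.V k) (hvh : vh ∈ M.Trace k EE) (K : M.Elem) (j : Facet (M.elemRef K))
    (E : M.Face) :
    MemLp (fun y => D.flux t Pt vt vh K j E (M.facetPoint K j y) (M.normal K j y)) ⊤
      ((M.facetMeasure K j).restrict (M.facePart K j E)) :=
  ((memLp_stress_normal hP K j).restrict _).sub (hD.memLp_stabilization ht hv hvh K j E)

theorem Admissible.faceIntegrable_flux_trace (hD : D.Admissible T) (ht : t ∈ Ioo 0 T)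
    (hP : Pt ∈ M.Q k) (hv : vt ∈ M.V k) (hvh : vh ∈ M.Trace k EE) :
    M.FaceIntegrable univ fun K j E x ν => D.flux t Pt vt vh K j E x ν ⬝ᵥ vh E x :=
  fun K j E _ _ => (memLp_dotProduct (hD.memLp_flux ht hP hv hvh K j E)
    (M.memLp_facePart K j (Mesh.continuousOn_of_mem_Trace hvh E))).integrable le_top

theorem Admissible.faceIntegrable_flux_field (hD : D.Admissible T) (ht : t ∈ Ioo 0 T)
    (hP : Pt ∈ M.Q k) (hv : vt ∈ M.V k) (hvh : vh ∈ M.Trace k EE) :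
    M.FaceIntegrable univ fun K j E x ν => D.flux t Pt vt vh K j E x ν ⬝ᵥ vt K x :=
  fun K j E _ _ => (memLp_dotProduct (hD.memLp_flux ht hP hv hvh K j E)
    ((M.memLp_facetPoint j (Mesh.continuousOn_of_mem_V hv K)).restrict _)).integrable le_top

theorem Admissible.faceIntegrable_dissipation (hD : D.Admissible T) (ht : t ∈ Ioo 0 T)
    (hv : vt ∈ M.V k) (hvh : vh ∈ M.Trace k EE) :
    M.FaceIntegrable univ fun K j E x _ =>
      (D.S t K j x).mulVec (jump vt vh K E x) ⬝ᵥ jump vt vh K E x :=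
  fun K j E _ _ => (memLp_dotProduct (hD.memLp_stabilization ht hv hvh K j E)
    (memLp_jump hv hvh K j E)).integrable le_top

theorem faceIntegrable_stress_field (hP : Pt ∈ M.Q k) (hv : vt ∈ M.V k) :
    M.FaceIntegrable univ fun K _ _ x ν => (Pt K x).mulVec ν ⬝ᵥ vt K x :=
  fun K j _ _ _ => (memLp_dotProduct ((memLp_stress_normal hP K j).restrict _)
    ((M.memLp_facetPoint j (Mesh.continuousOn_of_mem_V hv K)).restrict _)).integrable le_top

theorem faceIntegrable_trace_stress (hP : Pt ∈ M.Q k) (hvh : vh ∈ M.Trace k EE) :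
    M.FaceIntegrable univ fun K _ E x ν => vh E x ⬝ᵥ (Pt K x).mulVec ν :=
  fun K j E _ _ => (memLp_dotProduct
    (M.memLp_facePart K j (Mesh.continuousOn_of_mem_Trace hvh E))
    ((memLp_stress_normal hP K j).restrict _)).integrable le_top

theorem faceIntegrable_trace_trace (hvh : vh ∈ M.Trace k EE) :
    M.FaceIntegrable univ fun _ _ E x _ => vh E x ⬝ᵥ vh E x :=
  fun K j E _ _ => (memLp_dotProduct
    (M.memLp_facePart K j (Mesh.continuousOn_of_mem_Trace hvh E))
    (M.memLp_facePart K j (Mesh.continuousOn_of_mem_Trace hvh E))).integrable le_top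

theorem Admissible.faceIntegrable_traction (hD : D.Admissible T) (ht : t ∈ Ioo 0 T)
    (hvh : vh ∈ M.Trace k EE) :
    M.FaceIntegrable D.neumann fun _ _ E x _ => D.tN t x ⬝ᵥ vh E x :=
  fun K j E hE hs => by
    simp only [dotProduct_comm (D.tN t _)]
    exact (memLp_dotProduct (M.memLp_facePart K j (Mesh.continuousOn_of_mem_Trace hvh E))
      (hD.tN_memLp t ht K j E hE hs)).integrable one_le_two

end Faces

theorem IsSolution.kineticRate_eq (hsol : D.IsSolution k EE T F P v vhat) (ht : t ∈ Ioo 0 T)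
    (K : M.Elem) {x : Vec (n + 1)} (hx : x ∈ M.closedElem K) :
    deriv (fun s => 1 / 2 * D.rho x * (v s K x ⬝ᵥ v s K x)) t =
      D.rho x * (deriv (fun s => v s K x) t ⬝ᵥ v t K x) := by
  have h1 : ∀ i, HasDerivAt (fun s => v s K x i) (deriv (fun s => v s K x) t i) t :=
    hasDerivAt_pi.1 (hsol.v_diff t ht K x hx).hasDerivAt
  have h2 : HasDerivAt (fun s => v s K x ⬝ᵥ v s K x)
      (∑ i, (deriv (fun s => v s K x) t i * v t K x i +
        v t K x i * deriv (fun s => v s K x) t i)) t :=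
    HasDerivAt.fun_sum fun i _ => (h1 i).mul (h1 i)
  rw [(h2.const_mul (1 / 2 * D.rho x)).deriv]
  simp only [dotProduct, Finset.mul_sum]
  exact Finset.sum_congr rfl fun i _ => by ring

theorem IsSolution.energyRate_eq (hD : D.Admissible T) (hsol : D.IsSolution k EE T F P v vhat)
    (ht : t ∈ Ioo 0 T) :
    D.energyRate F P v t =
      M.elemSum (fun K x => D.rho x * (deriv (fun s => v s K x) t ⬝ᵥ v t K x)) +
        M.elemSum (fun K x => frob (P t K x) (deriv (fun s => F s K x) t)) := by
  have htI := Ioo_subset_Icc_self ht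
  rw [← Mesh.elemSum_add]
  · refine Mesh.elemSum_congr fun K x hx => ?_
    rw [hsol.kineticRate_eq ht K (M.elemSet_subset_closedElem K hx)]
  · intro K
    have h1 := memLp_dotProduct (M.memLp_elemSet (Mesh.continuousOn_of_mem_V
      (Mesh.deriv_mem_V ht hsol.v_mem (hsol.v_diff t ht)) K))
      (M.memLp_elemSet (Mesh.continuousOn_of_mem_V (hsol.v_mem t htI) K))
    exact (h1.mul' (p := ⊤) (q := ⊤) (r := ⊤) (hD.memLp_rho K)).integrable le_top
  · intro K
    exact Mesh.integrableOn_frob (Mesh.continuousOn_of_mem_Q (hsol.P_mem t ht) K)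
      (Mesh.continuousOn_of_mem_Q (Mesh.deriv_mem_Q ht hsol.F_mem (hsol.F_diff t ht)) K)

theorem Admissible.boundaryFaces_eq (hD : D.Admissible T) :
    M.boundaryFaces = D.neumann ∪ D.dirichlet :=
  (sdiff_union_of_subset hD.dirichlet_subset).symm

theorem disjoint_neumann_dirichlet : Disjoint D.neumann D.dirichlet := disjoint_sdiff_left

/-- The power of the numerical flux on the skeleton. -/
theorem IsSolution.faceSum_flux_trace (hD : D.Admissible T)
    (hsol : D.IsSolution k EE T F P v vhat) (ht : t ∈ Ioo 0 T) :
    M.faceSum univ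
        (fun K j E x ν => D.flux t (P t) (v t) (vhat t) K j E x ν ⬝ᵥ vhat t E x) =
      M.faceSum D.neumann (fun _ _ E x _ => D.tN t x ⬝ᵥ vhat t E x) +
        M.faceSum D.dirichlet
          (fun K j E x ν => D.flux t (P t) (v t) (vhat t) K j E x ν ⬝ᵥ vhat t E x) -
        M.faceSum D.dirichlet (fun _ _ E x _ => (vhat t E x - D.vD t x) ⬝ᵥ vhat t E x) := by
  have htI := Ioo_subset_Icc_self ht
  have hvh := hsol.vhat_mem t ht
  have hflux := hD.faceIntegrable_flux_trace ht (hsol.P_mem t ht) (hsol.v_mem t htI) hvh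
  -- The transmission condition contains the flux on interior and Neumann faces only. The flux on
  -- Dirichlet faces is added on both sides to complete the sum over the skeleton.
  have htr := hsol.transmission t ht (vhat t) hvh
  have h1 : M.faceSum D.neumann
      (fun K j E x ν => (D.flux t (P t) (v t) (vhat t) K j E x ν - D.tN t x) ⬝ᵥ vhat t E x) =
      M.faceSum D.neumann
        (fun K j E x ν => D.flux t (P t) (v t) (vhat t) K j E x ν ⬝ᵥ vhat t E x) -
      M.faceSum D.neumann (fun _ _ E x _ => D.tN t x ⬝ᵥ vhat t E x) := by
    simp only [sub_dotProduct]
    exact Mesh.faceSum_sub (hflux.mono (subset_univ _)) (hD.faceIntegrable_traction ht hvh)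
  have h2 := Mesh.faceSum_union (M := M) (A := M.boundaryFacesᶜ) (B := M.boundaryFaces)
    (g := fun K j E x ν => D.flux t (P t) (v t) (vhat t) K j E x ν ⬝ᵥ vhat t E x)
    disjoint_compl_left
  rw [compl_union_self, hD.boundaryFaces_eq, Mesh.faceSum_union disjoint_neumann_dirichlet,
    ← hD.boundaryFaces_eq] at h2
  rw [h1] at htr
  linarith

theorem IsSolution.energy_identity (hD : D.Admissible T) (hsol : D.IsSolution k EE T F P v vhat)
    (ht : t ∈ Ioo 0 T) :
    D.energyRate F P v t + D.dissipation v vhat t =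
      M.elemSum (fun K x => D.f t x ⬝ᵥ v t K x) +
      M.faceSum D.neumann (fun _ _ E x _ => D.tN t x ⬝ᵥ vhat t E x) +
      M.faceSum D.dirichlet
        (fun K j E x ν => D.flux t (P t) (v t) (vhat t) K j E x ν ⬝ᵥ vhat t E x) -
      M.faceSum D.dirichlet (fun _ _ E x _ => (vhat t E x - D.vD t x) ⬝ᵥ vhat t E x) := by
  have htI := Ioo_subset_Icc_self ht
  have hP := hsol.P_mem t ht
  have hv := hsol.v_mem t htI
  have hvh := hsol.vhat_mem t ht
  have hkin := hsol.kinematic t ht (P t) hP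
  have hmom := hsol.momentum t ht (v t) hv
  have hgreen := Mesh.elemSum_div_add_elemSum_grad hP hv
  have hskel := hsol.faceSum_flux_trace hD ht
  have hrate := hsol.energyRate_eq hD ht
  have hcomm : M.elemSum (fun K x => frob (P t K x) (deriv (fun s => F s K x) t)) =
      M.elemSum (fun K x => frob (deriv (fun s => F s K x) t) (P t K x)) :=
    Mesh.elemSum_congr fun K x _ => frob_comm _ _
  -- Pointwise, `P n · (v - v̂) = P̂ n · (v - v̂) + S (v - v̂) · (v - v̂)`. This is where the
  -- dissipation enters.
  have hpoint : M.faceSum univ (fun K _ _ x ν => (P t K x).mulVec ν ⬝ᵥ v t K x) -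
      M.faceSum univ (fun K _ E x ν => vhat t E x ⬝ᵥ (P t K x).mulVec ν) =
      M.faceSum univ (fun K j E x ν => D.flux t (P t) (v t) (vhat t) K j E x ν ⬝ᵥ v t K x) -
      M.faceSum univ (fun K j E x ν => D.flux t (P t) (v t) (vhat t) K j E x ν ⬝ᵥ vhat t E x) +
      D.dissipation v vhat t := by
    have i1 := hD.faceIntegrable_flux_field ht hP hv hvh
    have i2 := hD.faceIntegrable_flux_trace ht hP hv hvh
    rw [← Mesh.faceSum_sub (faceIntegrable_stress_field hP hv) (faceIntegrable_trace_stress hP hvh),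
      ← Mesh.faceSum_sub i1 i2, dissipation,
      ← Mesh.faceSum_add (i1.sub i2) (hD.faceIntegrable_dissipation ht hv hvh)]
    refine Mesh.faceSum_congr fun K j E _ y _ _ => ?_
    simp only [flux, jump, sub_dotProduct, dotProduct_sub, dotProduct_comm (vhat t E _)]
    ring
  linarith

/-- The Dirichlet condition tested with the trace itself, on Dirichlet faces without continuity
constraints. -/
theorem IsSolution.faceSum_dirichlet_eq_zero (hsol : D.IsSolution k EE T F P v vhat)
    (hEE : Disjoint EE D.dirichlet) (hsub : D.dirichlet ⊆ M.boundaryFaces) (ht : t ∈ Ioo 0 T) :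
    M.faceSum D.dirichlet (fun _ _ E x _ => (vhat t E x - D.vD t x) ⬝ᵥ vhat t E x) = 0 := by
  classical
  -- The cut-off jumps only between faces of which at least one is Dirichlet. Continuity is required
  -- only between faces of `EE`, and on all of these it is zero.
  let μ : M.Face → Vec (n + 1) → Vec (n + 1) := fun E x => if E ∈ D.dirichlet then vhat t E x else 0
  have hvh := hsol.vhat_mem t ht
  have hμ : μ ∈ M.Trace k EE := by
    refine ⟨fun E i => ?_, fun E hE E' hE' x _ => ?_⟩
    · by_cases h : E ∈ D.dirichlet
      · simpa [μ, h] using hvh.1 E i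
      · exact ⟨0, by simp, by simp [μ, h]⟩
    · simp [μ, disjoint_left.1 hEE hE, disjoint_left.1 hEE hE']
  have htr := hsol.transmission t ht μ hμ
  rw [Mesh.faceSum_eq_zero (A := M.boundaryFacesᶜ), Mesh.faceSum_eq_zero (A := D.neumann), zero_add,
    zero_add] at htr
  · rw [← htr]
    refine Mesh.faceSum_congr fun K j E hE y _ _ => ?_
    simp [μ, hE]
  · intro K j E hE y _ _
    simp [μ, hE.2]
  · intro K j E hE y _ _
    have : E ∉ D.dirichlet := fun h => hE (hsub h)
    simp [μ, this]

/-- With `v_D = 0` the vanishing Dirichlet residual is the integral of `|v̂_h|²`. Hence `v̂_h` is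
zero almost everywhere on the Dirichlet faces, and the flux does no work there. -/
theorem IsSolution.faceSum_flux_dirichlet_eq_zero (hD : D.Admissible T)
    (hsol : D.IsSolution k EE T F P v vhat)
    (hEE : Disjoint EE D.dirichlet) (ht : t ∈ Ioo 0 T)
    (hvD : ∀ E ∈ D.dirichlet, ∀ x ∈ M.faceSet E, D.vD t x = 0) :
    M.faceSum D.dirichlet
      (fun K j E x ν => D.flux t (P t) (v t) (vhat t) K j E x ν ⬝ᵥ vhat t E x) = 0 := by
  have h0 := hsol.faceSum_dirichlet_eq_zero hEE hD.dirichlet_subset ht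
  rw [Mesh.faceSum_congr (h := fun _ _ E x _ => vhat t E x ⬝ᵥ vhat t E x)
    fun K j E hE y _ hx => by rw [hvD E hE _ hx, sub_zero]] at h0
  have hae := Mesh.ae_eq_zero_of_faceSum_eq_zero
    ((faceIntegrable_trace_trace (hsol.vhat_mem t ht)).mono (subset_univ D.dirichlet))
    (fun K j E hE y _ _ => Finset.sum_nonneg fun i _ => mul_self_nonneg _) h0
  classical
  refine Finset.sum_eq_zero fun K _ => Finset.sum_eq_zero fun j _ => Finset.sum_eq_zero fun E hE =>
    integral_eq_zero_of_ae ?_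
  have hE' : E ∈ D.dirichlet ∧ M.faceSet E ⊆ M.facetSet K j := by simpa using hE
  filter_upwards [hae K j hE'.1 hE'.2] with y hy
  rw [dotProduct_self_eq_zero.1 hy, dotProduct_zero]
  rfl

end Data

/-! ### The strain energy -/

theorem contDiff_transpose_mul_self {d : ℕ} :
    ContDiff ℝ 1 (fun A : Mat d => A.transpose * A) := by
  have h : ∀ i j, ContDiff ℝ 1 (fun A : Mat d => A i j) := fun i j =>
    contDiff_apply_apply ℝ ℝ i j
  refine contDiff_pi.2 fun i => contDiff_pi.2 fun j => ?_
  simp only [Matrix.mul_apply, Matrix.transpose_apply]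
  exact ContDiff.sum fun l _ => (h l i).mul (h l j)

theorem contDiffOn_strainEnergy {d : ℕ} {W : Mat d → ℝ} {dom : Set (Mat d)}
    (hW : ContDiffOn ℝ 1 W dom) :
    ContDiffOn ℝ 1 (fun A : Mat d => W (A.transpose * A)) {A | A.transpose * A ∈ dom} :=
  hW.comp contDiff_transpose_mul_self.contDiffOn fun _ hA => hA

theorem isOpen_strainEnergy_domain {d : ℕ} {dom : Set (Mat d)} (hdom : IsOpen dom) :
    IsOpen {A : Mat d | A.transpose * A ∈ dom} :=
  hdom.preimage (contDiff_transpose_mul_self (d := d)).continuous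

/-- Expanding `l` in matrix units, the two summands of the rate of `AᵀA` contribute `l` on a unit
and on its transpose. Their sum is the symmetrization appearing in `piola2`, including its factor
`2`. -/
theorem apply_gram_rate_eq_frob {d : ℕ} (l : Mat d →ₗ[ℝ] ℝ) (A H : Mat d) :
    l (H.transpose * A + A.transpose * H) =
      frob (A * Matrix.of fun i j => l (Matrix.single i j 1) + l (Matrix.single j i 1)) H := by
  have hl : ∀ M : Mat d, l M = ∑ i, ∑ j, M i j * l (Matrix.single i j 1) := fun M => by
    conv_lhs => rw [Matrix.matrix_eq_sum_single M]
    simp only [map_sum]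
    refine Finset.sum_congr rfl fun i _ => Finset.sum_congr rfl fun j _ => ?_
    rw [← smul_eq_mul, ← map_smul, Matrix.smul_single, smul_eq_mul, mul_one]
  have h1 : l (H.transpose * A) = ∑ a, ∑ b, ∑ c, A a c * l (Matrix.single b c 1) * H a b := by
    rw [hl]
    simp only [Matrix.mul_apply, Matrix.transpose_apply, Finset.sum_mul]
    rw [Finset.sum_congr rfl fun i _ => Finset.sum_comm, Finset.sum_comm]
    exact Finset.sum_congr rfl fun a _ => Finset.sum_congr rfl fun b _ =>
      Finset.sum_congr rfl fun c _ => by ring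
  have h2 : l (A.transpose * H) = ∑ a, ∑ b, ∑ c, A a c * l (Matrix.single c b 1) * H a b := by
    rw [hl]
    simp only [Matrix.mul_apply, Matrix.transpose_apply, Finset.sum_mul]
    rw [Finset.sum_comm, Finset.sum_congr rfl fun i _ => Finset.sum_comm, Finset.sum_comm]
    exact Finset.sum_congr rfl fun a _ => Finset.sum_congr rfl fun b _ =>
      Finset.sum_congr rfl fun c _ => by ring
  rw [map_add, h1, h2, frob_eq_sum]
  simp only [Matrix.mul_apply, Matrix.of_apply, Finset.sum_mul, ← Finset.sum_add_distrib]
  exact Finset.sum_congr rfl fun a _ => Finset.sum_congr rfl fun b _ =>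
    Finset.sum_congr rfl fun c _ => by ring

/-- The derivative of the strain energy is the first Piola-Kirchhoff stress. -/
theorem fderiv_strainEnergy {d : ℕ} {W : Mat d → ℝ} {dom : Set (Mat d)} (hdom : IsOpen dom)
    (hW : ContDiffOn ℝ 1 W dom) {A : Mat d} (hA : A.transpose * A ∈ dom) (H : Mat d) :
    fderiv ℝ (fun A : Mat d => W (A.transpose * A)) A H = frob (A * piola2 W A) H := by
  have hΦ : HasFDerivAt (fun A : Mat d => W (A.transpose * A)) _ A :=
    (((contDiffOn_strainEnergy hW).differentiableOn one_ne_zero).differentiableAt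
      ((isOpen_strainEnergy_domain hdom).mem_nhds hA)).hasFDerivAt
  have hWd := ((hW.differentiableOn one_ne_zero).differentiableAt (hdom.mem_nhds hA)).hasFDerivAt
  have he : ∀ i j, HasDerivAt (fun s : ℝ => (A + s • H) i j) (H i j) 0 := fun i j => by
    simpa using ((hasDerivAt_id (0 : ℝ)).mul_const (H i j)).const_add (A i j)
  -- The energy is differentiated along this line in two ways: through `A ↦ W (Aᵀ A)` as a whole,
  -- and through `W` composed with the curve of Gram matrices.
  have hline : HasDerivAt (fun s : ℝ => A + s • H) H 0 :=
    hasDerivAt_pi.2 fun i => hasDerivAt_pi.2 fun j => he i j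
  have hgram : HasDerivAt (fun s : ℝ => (A + s • H).transpose * (A + s • H))
      (H.transpose * A + A.transpose * H) 0 := by
    refine hasDerivAt_pi.2 fun i => hasDerivAt_pi.2 fun j => ?_
    have h1 : HasDerivAt (fun s : ℝ => ∑ l, (A + s • H) l i * (A + s • H) l j)
        (∑ l, (H l i * (A + (0 : ℝ) • H) l j + (A + (0 : ℝ) • H) l i * H l j)) 0 :=
      HasDerivAt.fun_sum fun l _ => (he l i).mul (he l j)
    refine h1.congr_deriv ?_
    simp [Matrix.mul_apply, Finset.sum_add_distrib]
  have h0 : A + (0 : ℝ) • H = A := by simp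
  have hd1 : HasDerivAt (fun s : ℝ => W ((A + s • H).transpose * (A + s • H)))
      (fderiv ℝ (fun A : Mat d => W (A.transpose * A)) A H) 0 := by
    rw [← h0] at hΦ
    have := hΦ.comp_hasDerivAt (0 : ℝ) hline
    rwa [h0] at this
  have hd2 : HasDerivAt (fun s : ℝ => W ((A + s • H).transpose * (A + s • H)))
      (fderiv ℝ W (A.transpose * A) (H.transpose * A + A.transpose * H)) 0 :=
    HasFDerivAt.comp_hasDerivAt (l := W) (0 : ℝ) (by rw [h0]; exact hWd) hgram
  rw [hd1.unique hd2]
  exact apply_gram_rate_eq_frob (fderiv ℝ W (A.transpose * A)).toLinearMap A H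

namespace Data

variable {n p k : ℕ} {Ω : Set (Vec (n + 1))} {M : Mesh n p Ω} {D : Data M} {T t : ℝ}
  {EE : Set M.Face} {F P : ℝ → M.Elem → Vec (n + 1) → Mat (n + 1)}
  {v : ℝ → M.Elem → Vec (n + 1) → Vec (n + 1)} {vhat : ℝ → M.Face → Vec (n + 1) → Vec (n + 1)}

/-! ### The rate of the discrete energy -/

theorem Admissible.hasDerivAt_elasticEnergy_elem (hD : D.Admissible T)
    (hsol : D.IsSolution k EE T F P v vhat) (ht : t ∈ Ioo 0 T) (K : M.Elem) :
    HasDerivAt (fun s => ∫ x in M.elemSet K, D.W K ((F s K x).transpose * F s K x))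
      (∫ x in M.elemSet K, frob (F t K x * piola2 (D.W K) (F t K x))
        (deriv (fun s => F s K x) t)) t := by
  obtain ⟨ι, hι, pt, B, hpt, hB, H, -⟩ := M.exists_nodalBasis_fields k K
  have hIcc : Icc 0 T ∈ nhds t := Icc_mem_nhds ht.1 ht.2
  have hdom : ∀ s ∈ Icc 0 T, ∀ x ∈ M.closedElem K,
      ∑ i, B i x • F s K (pt i) ∈ {A : Mat (n + 1) | A.transpose * A ∈ D.dom K} :=
    fun s hs x hx => by
      rw [← H _ (hsol.F_mem s hs) x hx]
      exact hsol.F_dom s hs K x hx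
  have key := hasDerivAt_energy (μ := volume.restrict (M.elemSet K)) (r := fun _ => 1)
    (c := fun i s => F s K (pt i)) (c' := fun i => deriv (fun s => F s K (pt i)) t) (t := t)
    (M.isCompact_closedElem K)
    (M.isCompact_closedElem K).measurableSet (Mesh.restrict_closedElem K)
    (fun i => (hB i).continuousOn) (memLp_const 1) (isOpen_strainEnergy_domain (hD.dom_open K))
    (contDiffOn_strainEnergy (hD.W_contDiff K))
    (fun i => (hsol.F_diff t ht K _ (hpt i)).hasDerivAt)
    (Filter.eventually_of_mem hIcc hdom)
  refine (key.congr_of_eventuallyEq ?_).congr_deriv ?_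
  · filter_upwards [hIcc] with s hs
    refine setIntegral_congr_fun (M.measurableSet_elemSet K) fun x hx => ?_
    simp only [one_mul]
    rw [← H _ (hsol.F_mem s hs) x (M.elemSet_subset_closedElem K hx)]
  · refine setIntegral_congr_fun (M.measurableSet_elemSet K) fun x hx => ?_
    have hx' := M.elemSet_subset_closedElem K hx
    have htI := Ioo_subset_Icc_self ht
    have hd := Mesh.deriv_eq_sum_smul ht (fun s hs => H _ (hsol.F_mem s hs) x hx')
      fun a => hsol.F_diff t ht K _ (hpt a)
    have hF := H _ (hsol.F_mem t htI) x hx'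
    simp only [one_mul]
    rw [← hF]
    refine (fderiv_strainEnergy (hD.dom_open K) (hD.W_contDiff K)
      (hsol.F_dom t htI K x hx') _).trans ?_
    exact congrArg _ hd.symm

/-- `P_h` need not equal `F_h 𝐒(F_h)` pointwise. The constitutive equation equates only their
pairings with `Q_h`, and the rate of the elastic energy is such a pairing, namely with `∂ₜF_h`. -/
theorem IsSolution.hasDerivAt_elasticEnergy (hD : D.Admissible T)
    (hsol : D.IsSolution k EE T F P v vhat) (ht : t ∈ Ioo 0 T) :
    HasDerivAt (D.elasticEnergy F)
      (M.elemSum fun K x => frob (P t K x) (deriv (fun s => F s K x) t)) t := by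
  have h1 := hsol.constitutive t ht _ (Mesh.deriv_mem_Q ht hsol.F_mem (hsol.F_diff t ht))
  rw [sub_eq_zero.1 h1]
  exact HasDerivAt.fun_sum fun K _ => hD.hasDerivAt_elasticEnergy_elem hsol ht K

theorem contDiff_dotProduct_self {d : ℕ} : ContDiff ℝ 1 fun w : Vec d => 1 / 2 * (w ⬝ᵥ w) :=
  contDiff_const.mul (ContDiff.sum fun i _ => (contDiff_apply ℝ ℝ i).mul (contDiff_apply ℝ ℝ i))

theorem fderiv_dotProduct_self {d : ℕ} (w h : Vec d) :
    fderiv ℝ (fun w : Vec d => 1 / 2 * (w ⬝ᵥ w)) w h = h ⬝ᵥ w := by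
  have hp : ∀ i, HasFDerivAt (fun w : Vec d => w i)
      (ContinuousLinearMap.proj (R := ℝ) (φ := fun _ : Fin d => ℝ) i) w := fun i =>
    (ContinuousLinearMap.proj (R := ℝ) (φ := fun _ : Fin d => ℝ) i).hasFDerivAt
  have h1 : HasFDerivAt (fun w : Vec d => 1 / 2 * (w ⬝ᵥ w)) _ w :=
    (HasFDerivAt.fun_sum fun i _ => (hp i).mul (hp i)).const_mul (1 / 2)
  rw [h1.fderiv]
  simp only [smul_apply, sum_apply, add_apply, ContinuousLinearMap.proj_apply, smul_eq_mul,
    dotProduct, Finset.mul_sum]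
  exact Finset.sum_congr rfl fun i _ => by ring

/-- The density does not depend on time and enters only as a bounded weight; the quadratic form is
smooth on the whole space, so no domain condition arises. -/
theorem IsSolution.hasDerivAt_kineticEnergy (hD : D.Admissible T)
    (hsol : D.IsSolution k EE T F P v vhat) (ht : t ∈ Ioo 0 T) :
    HasDerivAt (D.kineticEnergy v)
      (M.elemSum fun K x => D.rho x * (deriv (fun s => v s K x) t ⬝ᵥ v t K x)) t := by
  refine HasDerivAt.fun_sum fun K _ => ?_
  obtain ⟨ι, hι, pt, B, hpt, hB, -, H⟩ := M.exists_nodalBasis_fields k K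
  have hIcc : Icc 0 T ∈ nhds t := Icc_mem_nhds ht.1 ht.2
  have key := hasDerivAt_energy (μ := volume.restrict (M.elemSet K)) (r := D.rho)
    (c := fun i s => v s K (pt i)) (c' := fun i => deriv (fun s => v s K (pt i)) t) (t := t)
    (M.isCompact_closedElem K)
    (M.isCompact_closedElem K).measurableSet (Mesh.restrict_closedElem K)
    (fun i => (hB i).continuousOn) (hD.memLp_rho K) isOpen_univ
    contDiff_dotProduct_self.contDiffOn
    (fun i => (hsol.v_diff t ht K _ (hpt i)).hasDerivAt) (by simp)
  refine (key.congr_of_eventuallyEq ?_).congr_deriv ?_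
  · filter_upwards [hIcc] with s hs
    refine setIntegral_congr_fun (M.measurableSet_elemSet K) fun x hx => ?_
    rw [← H _ (hsol.v_mem s hs) x (M.elemSet_subset_closedElem K hx)]
    ring
  · refine setIntegral_congr_fun (M.measurableSet_elemSet K) fun x hx => ?_
    have hx' := M.elemSet_subset_closedElem K hx
    simp only
    rw [fderiv_dotProduct_self, ← H _ (hsol.v_mem t (Ioo_subset_Icc_self ht)) x hx',
      Mesh.deriv_eq_sum_smul ht (fun s hs => H _ (hsol.v_mem s hs) x hx')
        fun a => hsol.v_diff t ht K _ (hpt a)]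

theorem IsSolution.hasDerivAt_energy (hD : D.Admissible T)
    (hsol : D.IsSolution k EE T F P v vhat) (ht : t ∈ Ioo 0 T) :
    HasDerivAt (fun s => D.kineticEnergy v s + D.elasticEnergy F s) (D.energyRate F P v t) t := by
  rw [hsol.energyRate_eq hD ht]
  exact (hsol.hasDerivAt_kineticEnergy hD ht).add (hsol.hasDerivAt_elasticEnergy hD ht)

theorem IsSolution.continuousOn_energy (hD : D.Admissible T)
    (hsol : D.IsSolution k EE T F P v vhat) :
    ContinuousOn (fun s => D.kineticEnergy v s + D.elasticEnergy F s) (Icc 0 T) := by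
  refine ContinuousOn.add (continuousOn_finsetSum _ fun K _ => ?_)
    (continuousOn_finsetSum _ fun K _ => ?_)
  · obtain ⟨ι, hι, pt, B, hpt, hB, -, H⟩ := M.exists_nodalBasis_fields k K
    refine (HDG.continuousOn_energy (μ := volume.restrict (M.elemSet K)) (r := D.rho)
      (c := fun i s => v s K (pt i)) (O := univ) (T := T) (M.isCompact_closedElem K)
      (M.isCompact_closedElem K).measurableSet (Mesh.restrict_closedElem K)
      (fun i => (hB i).continuousOn) (hD.memLp_rho K)
      contDiff_dotProduct_self.continuous.continuousOn
      (fun i => hsol.v_cont K _ (hpt i)) (by simp)).congr fun s hs => ?_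
    refine setIntegral_congr_fun (M.measurableSet_elemSet K) fun x hx => ?_
    simp only
    rw [← H _ (hsol.v_mem s hs) x (M.elemSet_subset_closedElem K hx)]
    ring
  · obtain ⟨ι, hι, pt, B, hpt, hB, H, -⟩ := M.exists_nodalBasis_fields k K
    refine (HDG.continuousOn_energy (μ := volume.restrict (M.elemSet K)) (r := fun _ => 1)
      (c := fun i s => F s K (pt i)) (O := {A : Mat (n + 1) | A.transpose * A ∈ D.dom K}) (T := T)
      (M.isCompact_closedElem K)
      (M.isCompact_closedElem K).measurableSet (Mesh.restrict_closedElem K)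
      (fun i => (hB i).continuousOn) (memLp_const 1)
      (contDiffOn_strainEnergy (hD.W_contDiff K)).continuousOn
      (fun i => hsol.F_cont K _ (hpt i)) fun s hs x hx => ?_).congr fun s hs => ?_
    · rw [← H _ (hsol.F_mem s hs) x hx]
      exact hsol.F_dom s hs K x hx
    · refine setIntegral_congr_fun (M.measurableSet_elemSet K) fun x hx => ?_
      simp only [one_mul]
      rw [← H _ (hsol.F_mem s hs) x (M.elemSet_subset_closedElem K hx)]

end Data

namespace Data

variable {n p k : ℕ} {Ω : Set (Vec (n + 1))} {M : Mesh n p Ω} {D : Data M} {T t : ℝ}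
  {EE : Set M.Face} {F P : ℝ → M.Elem → Vec (n + 1) → Mat (n + 1)}
  {v : ℝ → M.Elem → Vec (n + 1) → Vec (n + 1)} {vhat : ℝ → M.Face → Vec (n + 1) → Vec (n + 1)}

/-! ### Energy decay -/

theorem IsSolution.energy_identity_homogeneous (hD : D.Admissible T)
    (hsol : D.IsSolution k EE T F P v vhat) (hEE : Disjoint EE D.dirichlet) (ht : t ∈ Ioo 0 T)
    (hvD : ∀ E ∈ D.dirichlet, ∀ x ∈ M.faceSet E, D.vD t x = 0) :
    D.energyRate F P v t + D.dissipation v vhat t =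
      M.elemSum (fun K x => D.f t x ⬝ᵥ v t K x) +
      M.faceSum D.neumann (fun _ _ E x _ => D.tN t x ⬝ᵥ vhat t E x) := by
  rw [hsol.energy_identity hD ht, hsol.faceSum_dirichlet_eq_zero hEE hD.dirichlet_subset ht,
    hsol.faceSum_flux_dirichlet_eq_zero hD hEE ht hvD, add_zero, sub_zero]

theorem dotProduct_mulVec_self_nonneg {d : ℕ} {A : Mat d}
    (hA : ∀ w : Vec d, w ≠ 0 → 0 < A.mulVec w ⬝ᵥ w) (w : Vec d) : 0 ≤ A.mulVec w ⬝ᵥ w := by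
  rcases eq_or_ne w 0 with rfl | hw
  · simp
  · exact (hA w hw).le

theorem dissipation_nonneg
    (hS : ∀ K (j : Facet (M.elemRef K)), ∀ x ∈ M.facetSet K j,
      ∀ w : Vec (n + 1), w ≠ 0 → 0 < (D.S t K j x).mulVec w ⬝ᵥ w) :
    0 ≤ D.dissipation v vhat t :=
  Mesh.faceSum_nonneg fun K j _ _ _ hy _ =>
    dotProduct_mulVec_self_nonneg (hS K j _ (mem_image_of_mem _ hy)) _

theorem IsSolution.ae_eq_trace_of_dissipation_eq_zero (hD : D.Admissible T)
    (hsol : D.IsSolution k EE T F P v vhat) (ht : t ∈ Ioo 0 T)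
    (hS : ∀ K (j : Facet (M.elemRef K)), ∀ x ∈ M.facetSet K j,
      ∀ w : Vec (n + 1), w ≠ 0 → 0 < (D.S t K j x).mulVec w ⬝ᵥ w)
    (h0 : D.dissipation v vhat t = 0) (K : M.Elem) (j : Facet (M.elemRef K)) {E : M.Face}
    (hE : M.faceSet E ⊆ M.facetSet K j) :
    ∀ᵐ y ∂(M.facetMeasure K j).restrict (M.facePart K j E),
      v t K (M.facetPoint K j y) = vhat t E (M.facetPoint K j y) := by
  have hae := Mesh.ae_eq_zero_of_faceSum_eq_zero
    (hD.faceIntegrable_dissipation ht (hsol.v_mem t (Ioo_subset_Icc_self ht))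
      (hsol.vhat_mem t ht))
    (fun K j _ _ _ hy _ => dotProduct_mulVec_self_nonneg (hS K j _ (mem_image_of_mem _ hy)) _)
    h0 K j (mem_univ E) hE
  filter_upwards [hae, M.ae_mem_facePart K j E] with y hy hmem
  by_contra hne
  exact (hS K j _ (mem_image_of_mem _ hmem.1) _ (sub_ne_zero.2 hne)).ne' hy

end Data

end HDG

end

/-! ### Assembly of the conclusions -/

theorem mainTheorem2 {n p k : ℕ} {Ω : Set (HDG.Vec (n + 1))}
    (hΩ_open : IsOpen Ω) (hΩ_conn : IsConnected Ω) (hΩ_bdd : Bornology.IsBounded Ω)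
    (M : HDG.Mesh n p Ω) (D : HDG.Data M) {T : ℝ} (hT : 0 < T) (hD : D.Admissible T)
    (EE : Set M.Face)
    (F P : ℝ → M.Elem → HDG.Vec (n + 1) → HDG.Mat (n + 1))
    (v : ℝ → M.Elem → HDG.Vec (n + 1) → HDG.Vec (n + 1))
    (vhat : ℝ → M.Face → HDG.Vec (n + 1) → HDG.Vec (n + 1))
    (hsol : D.IsSolution k EE T F P v vhat) :
    -- the energy identity, with the power on the Dirichlet boundary
    (∀ t ∈ Set.Ioo 0 T,
      D.energyRate F P v t + D.dissipation v vhat t =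
        M.elemSum (fun K x => D.f t x ⬝ᵥ v t K x) +
        M.faceSum D.neumann (fun _ _ E x _ => D.tN t x ⬝ᵥ vhat t E x) +
        M.faceSum D.dirichlet
          (fun K j E x ν => D.flux t (P t) (v t) (vhat t) K j E x ν ⬝ᵥ vhat t E x) -
        M.faceSum D.dirichlet (fun _ _ E x _ => (vhat t E x - D.vD t x) ⬝ᵥ vhat t E x)) ∧
    -- the second part of the energy rate is the rate of the elastic energy
    (∀ t ∈ Set.Ioo 0 T,
      HasDerivAt (D.elasticEnergy F)
        (M.elemSum fun K x => HDG.frob (P t K x) (deriv (fun s => F s K x) t)) t ∧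
      HasDerivAt (fun s => D.kineticEnergy v s + D.elasticEnergy F s)
        (D.energyRate F P v t) t) ∧
    -- if the traces are discontinuous on the Dirichlet faces, the last term vanishes
    (Disjoint EE D.dirichlet → ∀ t ∈ Set.Ioo 0 T,
      M.faceSum D.dirichlet (fun _ _ E x _ => (vhat t E x - D.vD t x) ⬝ᵥ vhat t E x) = 0) ∧
    -- homogeneous Dirichlet data
    (Disjoint EE D.dirichlet →
      (∀ t ∈ Set.Ioo 0 T, ∀ E ∈ D.dirichlet, ∀ x ∈ M.faceSet E, D.vD t x = 0) →
      (∀ t ∈ Set.Ioo 0 T,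
        D.energyRate F P v t + D.dissipation v vhat t =
          M.elemSum (fun K x => D.f t x ⬝ᵥ v t K x) +
          M.faceSum D.neumann (fun _ _ E x _ => D.tN t x ⬝ᵥ vhat t E x)) ∧
      -- no external actions, positive definite stabilization
      ((∀ t ∈ Set.Ioo 0 T, ∀ x ∈ Ω, D.f t x = 0) →
        (∀ t ∈ Set.Ioo 0 T, ∀ E ∈ D.neumann, ∀ x ∈ M.faceSet E, D.tN t x = 0) →
        (∀ t ∈ Set.Ioo 0 T, ∀ K (j : HDG.Facet (M.elemRef K)), ∀ x ∈ M.facetSet K j,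
          ∀ w : HDG.Vec (n + 1), w ≠ 0 → 0 < (D.S t K j x).mulVec w ⬝ᵥ w) →
        AntitoneOn (fun s => D.kineticEnergy v s + D.elasticEnergy F s) (Set.Icc 0 T) ∧
        ∀ t ∈ Set.Ioo 0 T,
          deriv (fun s => D.kineticEnergy v s + D.elasticEnergy F s) t =
            - D.dissipation v vhat t ∧
          0 ≤ D.dissipation v vhat t ∧
          (D.dissipation v vhat t = 0 →
            ∀ K (j : HDG.Facet (M.elemRef K)) E, M.faceSet E ⊆ M.facetSet K j →
              ∀ᵐ y ∂(M.facetMeasure K j).restrict (M.facePart K j E),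
                v t K (M.facetPoint K j y) = vhat t E (M.facetPoint K j y)))) := by

  refine ⟨fun t ht => hsol.energy_identity hD ht,
    fun t ht => ⟨hsol.hasDerivAt_elasticEnergy hD ht, hsol.hasDerivAt_energy hD ht⟩,
    fun hEE t ht => hsol.faceSum_dirichlet_eq_zero hEE hD.dirichlet_subset ht,
    fun hEE hvD => ⟨fun t ht => hsol.energy_identity_homogeneous hD hEE ht (hvD t ht),
      fun hf htN hS => ?_⟩⟩
  -- Without external actions the right side of the homogeneous identity vanishes, and the energy
  -- rate is the derivative of the total energy.
  have hderiv : ∀ t ∈ Ioo 0 T, deriv (fun s => D.kineticEnergy v s + D.elasticEnergy F s) t =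
      -D.dissipation v vhat t := fun t ht => by
    have h := hsol.energy_identity_homogeneous hD hEE ht (hvD t ht)
    rw [HDG.Mesh.faceSum_eq_zero fun K j E hE y _ hx => by rw [htN t ht E hE _ hx, zero_dotProduct],
      HDG.Mesh.elemSum_congr (h := fun _ _ => 0) fun K x hx => by
        rw [hf t ht x (M.elemSet_subset K hx), zero_dotProduct]] at h
    rw [(hsol.hasDerivAt_energy hD ht).deriv]
    simp only [HDG.Mesh.elemSum, integral_zero, Finset.sum_const_zero, add_zero] at h
    linarith
  refine ⟨antitoneOn_of_deriv_nonpos (convex_Icc 0 T) (hsol.continuousOn_energy hD) ?_ ?_,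
    fun t ht => ⟨hderiv t ht, HDG.Data.dissipation_nonneg (hS t ht),
      fun h0 K j E hE => hsol.ae_eq_trace_of_dissipation_eq_zero hD ht (hS t ht) h0 K j hE⟩⟩
  · rw [interior_Icc]
    exact fun t ht => (hsol.hasDerivAt_energy hD ht).differentiableAt.differentiableWithinAt
  · rw [interior_Icc]
    intro t ht
    rw [hderiv t ht]
    exact neg_nonpos.2 (HDG.Data.dissipation_nonneg (hS t ht))
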